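/- **Setting.** Let $G$ be a connected finite-dimensional real Lie group with Lie algebra $\mathfrak g=T_eG$ (bracket of left-invariant vector fields). Write $\xi_G(g)=g\xi$ for the fundamental vector field of right multiplication, $\langle \mathrm{Ad}^*_g\nu,\eta\rangle=\langle\nu,\mathrm{Ad}_g\eta\rangle$, $\langle\mathrm{ad}^*_\xi\nu,\eta\rangle=\langle\nu,[\xi,\eta]\rangle$, and $\mathcal A(g)(v_g)=g^{-1}v_g$ (Maurer–Cartan connection). Let $\mathcal B$ be a smooth closed $2$-form on $G$, invariant under right multiplication, and let $\delta:G\to\mathfrak g^*$ be a smooth $\mathcal B\mathfrak g$-potential, i.e. $i_{\xi_G}\mathcal B=d\langle\delta,\xi\rangle$ for all $\xi\in\mathfrak g$. Put $\sigma_\delta(g)=\delta(g^{-1})-\mathrm{Ad}^*_{g^{-1}}\delta(e)$ and $\Sigma_\delta(\xi,\eta)=-\langle T_e\sigma_\delta(\xi),\eta\rangle$. Fix $\mu\in\mathfrak g^*$. Let $\tilde{\mathcal O}_\mu$ and $G_\mu$ be the orbit and the isotropy group of $\mu$ for the affine action $(g,\nu)\mapsto \mathrm{Ad}^*_g\nu-\sigma_\delta(g^{-1})$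 of $G$ on $\mathfrak g^*$. **Claim.** 1. $G_\mu$ is a subgroup, and $G/G_\mu$ (the orbits $gG_\mu$, with the quotient topology) has a smooth manifold structure for which the projection $\pi:G\to G/G_\mu$ is a submersion. The map $j:[g]\mapsto \mathrm{Ad}^*_{g^{-1}}\mu-\sigma_\delta(g)$ is a well-defined injective smooth immersion $G/G_\mu\to\mathfrak g^*$ with image $\tilde{\mathcal O}_\mu$. It sends the projection of the tangent vector $\xi g\in T_gG$ to $-\mathrm{ad}^*_\xi\nu+i_\xi\Sigma_\delta$, where $\nu=j([g])$. 2. There is exactly one $2$-form $\tilde{\mathcal B}$ on $G/G_\mu\cong\tilde{\mathcal O}_\mu$ with $\pi^*\tilde{\mathcal B}=\mathcal B+d\langle\mu+\delta,\mathcal A\rangle$. It is symplectic (smooth, closed, nondegenerate) and is the affine Kirillov–Kostant–Souriau form: at $\nu\in\tilde{\mathcal O}_\mu$, for all $\xi,\eta\in\mathfrak g$, $$\tilde{\mathcal B}(\nu)\big(-\mathrm{ad}^*_\xi\nu+i_\xi\Sigma_\delta,\,-\mathrm{ad}^*_\eta\nu+i_\eta\Sigma_\delta\big)=-\langle\nu,[\xi,\eta]\rangle+\Sigma_\delta(\xi,\eta).$$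 3. Let $\ell:\mathfrak g\to\mathbb R$ be smooth and $L(g,v_g)=\ell(v_gg^{-1})$, with momentum map $\langle J_{L,\delta}(v_g),\xi\rangle=\langle\mathbb FL(v_g),\xi_G(g)\rangle-\langle\delta(g),\xi\rangle$. Assume that $L$ is $G$-regular, i.e. $\xi\mapsto J_{L,\delta}(v_g+\xi_G(g))$ is a diffeomorphism $\mathfrak g\to\mathfrak g^*$ for every $v_g\in TG$. Then $\mathbb F\ell:\mathfrak g\to\mathfrak g^*$ has a smooth inverse $\chi$. The restriction of $L-\langle\mu+\delta,\mathcal A\rangle$ to $J_{L,\delta}^{-1}(\mu)$ descends to a unique function $\tilde L$ on $G/G_\mu\cong\tilde{\mathcal O}_\mu$ (the Routhian), which is smooth. If $\delta$ is normalized by $\delta(e)=0$, then for every curve in $G/G_\mu$ and every time at which the curve is differentiable, with image $\nu(t)$ in $\tilde{\mathcal O}_\mu$, the reduced Euler–Lagrange equations $i_{\dot\nu}\tilde{\mathcal B}=d\tilde L$ hold at that time if and only if $$\dot\nu=-\mathrm{ad}^*_{\chi(\nu)}\nu+i_{\chi(\nu)}\Sigma_\delta .$$ -/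

import Mathlib

open scoped Manifold ContDiff

noncomputable section

namespace RouthLie

/-! ### Differential forms on manifolds modelled on a normed space -/

section Forms

variable {F : Type*} [NormedAddCommGroup F] [NormedSpace ℝ F]
variable {F' : Type*} [NormedAddCommGroup F'] [NormedSpace ℝ F']

/-- A (not necessarily smooth) real differential `k`-form on a manifold `M` modelled on `F`. -/
abbrev DiffForm (F : Type*) [NormedAddCommGroup F] [NormedSpace ℝ F]
    (M : Type*) [TopologicalSpace M] [ChartedSpace F M] (k : ℕ) : Type _ :=
  (x : M) → (TangentSpace 𝓘(ℝ, F) x) [⋀^Fin k]→L[ℝ] ℝ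

variable {M : Type*} [TopologicalSpace M] [ChartedSpace F M]
variable {M' : Type*} [TopologicalSpace M'] [ChartedSpace F' M']

/-- The pull-back `f^* Ω` of a form along a map. -/
def DiffForm.pullback {k : ℕ} (f : M → M') (Ω : DiffForm F' M' k) : DiffForm F M k :=
  fun x => (Ω (f x)).compContinuousLinearMap (mfderiv 𝓘(ℝ, F) 𝓘(ℝ, F') f x)

/-- The coordinate expression of a form in the preferred chart around `x`: the pull-back of the
form along the inverse chart, a form on (an open subset of) the model space. -/
def DiffForm.inChart {k : ℕ} (Ω : DiffForm F M k) (x : M) : F → F [⋀^Fin k]→L[ℝ] ℝ :=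
  fun y => (Ω ((extChartAt 𝓘(ℝ, F) x).symm y)).compContinuousLinearMap
    (mfderiv 𝓘(ℝ, F) 𝓘(ℝ, F) (extChartAt 𝓘(ℝ, F) x).symm y : F →L[ℝ] _)

/-- A form is smooth if its coordinate expressions are. -/
def DiffForm.IsSmooth {k : ℕ} (Ω : DiffForm F M k) : Prop :=
  ∀ x : M, ContDiffOn ℝ ∞ (Ω.inChart x) (extChartAt 𝓘(ℝ, F) x).target

/-- The exterior derivative of a form, computed at `x` in the preferred chart around `x`. -/
def DiffForm.d {k : ℕ} (Ω : DiffForm F M k) : DiffForm F M (k + 1) :=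
  fun x => (extDeriv (Ω.inChart x) (extChartAt 𝓘(ℝ, F) x x)).compContinuousLinearMap
    (mfderiv 𝓘(ℝ, F) 𝓘(ℝ, F) (extChartAt 𝓘(ℝ, F) x) x : _ →L[ℝ] F)

/-- Symplectic forms: smooth, closed and nondegenerate `2`-forms. -/
structure DiffForm.IsSymplectic (Ω : DiffForm F M 2) : Prop where
  smooth : Ω.IsSmooth
  closed : Ω.d = 0
  nondegenerate : ∀ (x : M) (v : TangentSpace 𝓘(ℝ, F) x),
    (∀ w : TangentSpace 𝓘(ℝ, F) x, Ω x ![v, w] = 0) → v = 0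

/-- Smooth submersions (all manifolds here are finite-dimensional). -/
structure IsSmoothSubmersion (f : M → M') : Prop where
  smooth : ContMDiff 𝓘(ℝ, F) 𝓘(ℝ, F') ∞ f
  surjective : ∀ x : M, Function.Surjective (mfderiv 𝓘(ℝ, F) 𝓘(ℝ, F') f x)

/-- Injective smooth immersions (all manifolds here are finite-dimensional). -/
structure IsInjectiveImmersion (f : M → M') : Prop where
  smooth : ContMDiff 𝓘(ℝ, F) 𝓘(ℝ, F') ∞ f
  injective : Function.Injective f
  injective_mfderiv : ∀ x : M, Function.Injective (mfderiv 𝓘(ℝ, F) 𝓘(ℝ, F') f x)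

end Forms

/-! ### Lie groups

`G` is a Lie group modelled on `E`. Its Lie algebra `𝔤 = T_e G = GroupLieAlgebra 𝓘(ℝ, E) G` is,
as a vector space, by definition the model space `E`; its bracket is Mathlib's, given by
left-invariant vector fields. The dual `𝔤^*` is `E →L[ℝ] ℝ`. -/

section LieGroups

variable {E : Type*} [NormedAddCommGroup E] [NormedSpace ℝ E]
variable {G : Type*} [TopologicalSpace G] [ChartedSpace E G] [Group G]

instance lieGroupMinSmoothness [LieGroup 𝓘(ℝ, E) ∞ G] :
    LieGroup 𝓘(ℝ, E) (minSmoothness ℝ 3) G := by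
  rw [minSmoothness_of_isRCLikeNormedField]
  infer_instance

/-- The infinitesimal action `ξ ↦ d/dε|₀ g exp(ε ξ) = g ξ` of right multiplication at `g`. -/
def fundMap (g : G) : E →L[ℝ] TangentSpace 𝓘(ℝ, E) g :=
  (mfderiv 𝓘(ℝ, E) 𝓘(ℝ, E) (fun h : G => g * h) 1 : E →L[ℝ] E)

/-- The fundamental vector field `ξ_G` of the action of `G` on itself by right multiplication. -/
def fundField (ξ : E) (g : G) : TangentSpace 𝓘(ℝ, E) g := fundMap g ξ

/-- `ξ_G` is the left-invariant vector field with value `ξ` at the identity. -/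
theorem fundField_eq (ξ : E) :
    fundField (G := G) ξ = mulInvariantVectorField (I := 𝓘(ℝ, E)) (G := G) ξ := rfl

/-- The tangent vector `ξ g` at `g`. -/
def rightTranslate (ξ : E) (g : G) : TangentSpace 𝓘(ℝ, E) g :=
  (mfderiv 𝓘(ℝ, E) 𝓘(ℝ, E) (fun h : G => h * g) 1 : E →L[ℝ] E) ξ

/-- The Maurer–Cartan connection `𝓐(g)(v_g) = g⁻¹ v_g`. -/
def maurerCartan (g : G) : TangentSpace 𝓘(ℝ, E) g →L[ℝ] E :=
  (mfderiv 𝓘(ℝ, E) 𝓘(ℝ, E) (fun h : G => g⁻¹ * h) g : _ →L[ℝ] E)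

/-- The `1`-form `⟨f, 𝓐⟩` for a `𝔤^*`-valued function `f`. -/
def pairMC (f : G → E →L[ℝ] ℝ) : DiffForm E G 1 :=
  fun g => ContinuousAlternatingMap.ofSubsingleton ℝ _ _ (0 : Fin 1)
    ((f g).comp (maurerCartan g))

/-- The adjoint action `Ad_g`. -/
def Ad (g : G) : E →L[ℝ] E :=
  (mfderiv 𝓘(ℝ, E) 𝓘(ℝ, E) (fun h : G => g * h * g⁻¹) 1 : E →L[ℝ] E)

/-- The (right) coadjoint action, `⟨Ad^*_g ν, η⟩ = ⟨ν, Ad_g η⟩`. -/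
def coAd (g : G) (ν : E →L[ℝ] ℝ) : E →L[ℝ] ℝ := ν.comp (Ad g)

/-- `⟨f, 𝓐⟩` satisfies `⟨f, 𝓐⟩(g)(v) = ⟨f(g), g⁻¹ v⟩`. -/
theorem pairMC_apply (f : G → E →L[ℝ] ℝ) (g : G) (v : TangentSpace 𝓘(ℝ, E) g) :
    pairMC f g ![v] = f g (maurerCartan g v) := by
  simp [pairMC]

variable (G)

/-- The bracket of the Lie algebra of `G`. -/
def lieBr (ξ η : E) : E :=
  @Bracket.bracket (GroupLieAlgebra 𝓘(ℝ, E) G) (GroupLieAlgebra 𝓘(ℝ, E) G) _ ξ η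

/-- The bracket `(ξ, η) ↦ [ξ, η]` as a bilinear map. -/
def lieBrₗ [LieGroup 𝓘(ℝ, E) ∞ G] [CompleteSpace E] : E →ₗ[ℝ] E →ₗ[ℝ] E :=
  LinearMap.mk₂ ℝ (lieBr G)
    (@add_lie (GroupLieAlgebra 𝓘(ℝ, E) G) (GroupLieAlgebra 𝓘(ℝ, E) G) _ _ _)
    (@smul_lie ℝ (GroupLieAlgebra 𝓘(ℝ, E) G) (GroupLieAlgebra 𝓘(ℝ, E) G) _ _ _ _ _ _ _)
    (@lie_add (GroupLieAlgebra 𝓘(ℝ, E) G) (GroupLieAlgebra 𝓘(ℝ, E) G) _ _ _)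
    (@lie_smul ℝ (GroupLieAlgebra 𝓘(ℝ, E) G) (GroupLieAlgebra 𝓘(ℝ, E) G) _ _ _ _ _ _ _)

/-- The infinitesimal coadjoint action, `⟨ad^*_ξ ν, η⟩ = ⟨ν, [ξ, η]⟩`. -/
def coad [LieGroup 𝓘(ℝ, E) ∞ G] [CompleteSpace E] [FiniteDimensional ℝ E]
    (ξ : E) (ν : E →L[ℝ] ℝ) : E →L[ℝ] ℝ :=
  ν.comp (LinearMap.toContinuousLinearMap (lieBrₗ G ξ))

end LieGroups

/-! ### Magnetic terms, potentials and affine orbits -/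

section Magnetic

variable {E : Type*} [NormedAddCommGroup E] [NormedSpace ℝ E]
variable {G : Type*} [TopologicalSpace G] [ChartedSpace E G] [Group G]

/-- A magnetic term `B` on `G` that is invariant under right multiplication, together with a
`B𝔤`-potential `δ : G → 𝔤^*`, i.e. `i_{ξ_G} B = d δ_ξ` for all `ξ ∈ 𝔤`. -/
structure IsInvariantMagnetic (B : DiffForm E G 2) (δ : G → E →L[ℝ] ℝ) : Prop where
  smooth_form : B.IsSmooth
  closed : B.d = 0
  invariant : ∀ g : G, B.pullback (fun h : G => h * g) = B
  smooth_potential : ContMDiff 𝓘(ℝ, E) 𝓘(ℝ, E →L[ℝ] ℝ) ∞ δ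
  potential : ∀ (ξ : E) (g : G) (v : TangentSpace 𝓘(ℝ, E) g),
    B g ![fundField ξ g, v] = mfderiv 𝓘(ℝ, E) 𝓘(ℝ, ℝ) (fun h : G => δ h ξ) g v

/-- The `1`-cocycle `σ_δ(g) = δ(p g⁻¹) - Ad^*_{g⁻¹} δ(p)`, evaluated with `p = e`. -/
def cocycle (δ : G → E →L[ℝ] ℝ) (g : G) : E →L[ℝ] ℝ := δ g⁻¹ - coAd g⁻¹ (δ 1)

/-- The infinitesimal cocycle `Σ_δ(ξ, η) = -⟨T_e σ_δ(ξ), η⟩`; `infCocycle δ ξ` is `i_ξ Σ_δ`. -/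
def infCocycle (δ : G → E →L[ℝ] ℝ) : E →L[ℝ] (E →L[ℝ] ℝ) :=
  -(mfderiv 𝓘(ℝ, E) 𝓘(ℝ, E →L[ℝ] ℝ) (cocycle δ) 1 : E →L[ℝ] (E →L[ℝ] ℝ))

/-- The affine (right) action of `G` on `𝔤^*` with `1`-cocycle `σ`,
`(g, ν) ↦ Ad^*_g ν + σ(g⁻¹)`. -/
def affineAction (σ : G → E →L[ℝ] ℝ) (g : G) (ν : E →L[ℝ] ℝ) : E →L[ℝ] ℝ :=
  coAd g ν + σ g⁻¹

/-- The orbit `Õ_μ` of `μ` for the affine action with `1`-cocycle `-σ_δ`. -/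
def affineOrbit (δ : G → E →L[ℝ] ℝ) (μ : E →L[ℝ] ℝ) : Set (E →L[ℝ] ℝ) :=
  Set.range fun g : G => affineAction (-cocycle δ) g μ

variable [LieGroup 𝓘(ℝ, E) ∞ G] [CompleteSpace E] [FiniteDimensional ℝ E]

/-- The tangent vector `-ad^*_ξ ν + i_ξ Σ_δ` to the affine orbit at `ν`. -/
def orbitVector (δ : G → E →L[ℝ] ℝ) (ξ : E) (ν : E →L[ℝ] ℝ) : E →L[ℝ] ℝ :=
  -coad G ξ ν + infCocycle δ ξ

/-- The tangent space `{-ad^*_ξ ν + i_ξ Σ_δ | ξ ∈ 𝔤}` to the affine orbit at `ν`. -/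
def orbitTangent (δ : G → E →L[ℝ] ℝ) (ν : E →L[ℝ] ℝ) : Submodule ℝ (E →L[ℝ] ℝ) where
  carrier := Set.range fun ξ : E => orbitVector δ ξ ν
  zero_mem' := ⟨0, by ext; simp [orbitVector, coad]⟩
  add_mem' := by
    rintro _ _ ⟨ξ, rfl⟩ ⟨η, rfl⟩
    refine ⟨ξ + η, ?_⟩
    ext
    simp [orbitVector, coad]
    ring
  smul_mem' := by
    rintro c _ ⟨ξ, rfl⟩
    refine ⟨c • ξ, ?_⟩
    ext
    simp [orbitVector, coad]

/-- `Ω` is the affine Kirillov–Kostant–Souriau form, where the manifold `M` is regarded as an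
affine orbit by means of `j : M → 𝔤^*`: at the point `ν`,
`Ω(-ad^*_ξ ν + i_ξ Σ_δ, -ad^*_η ν + i_η Σ_δ) = -⟨ν, [ξ, η]⟩ + Σ_δ(ξ, η)`. -/
def IsAffineKKS {F : Type*} [NormedAddCommGroup F] [NormedSpace ℝ F]
    {M : Type*} [TopologicalSpace M] [ChartedSpace F M]
    (δ : G → E →L[ℝ] ℝ) (j : M → E →L[ℝ] ℝ) (Ω : DiffForm F M 2) : Prop :=
  ∀ (m : M) (v w : TangentSpace 𝓘(ℝ, F) m) (ξ η : E),
    mfderiv 𝓘(ℝ, F) 𝓘(ℝ, E →L[ℝ] ℝ) j m v = orbitVector δ ξ (j m) →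
    mfderiv 𝓘(ℝ, F) 𝓘(ℝ, E →L[ℝ] ℝ) j m w = orbitVector δ η (j m) →
    Ω m ![v, w] = -(j m) (lieBr G ξ η) + infCocycle δ ξ η

end Magnetic

/-! ### Right-invariant Lagrangians -/

section Lagrangian

variable {E : Type*} [NormedAddCommGroup E] [NormedSpace ℝ E]
variable {G : Type*} [TopologicalSpace G] [ChartedSpace E G] [Group G]

/-- The right-invariant Lagrangian `L(g, v_g) = ℓ(v_g g⁻¹)` on `TG`. -/
def lagrangian (ℓ : E → ℝ) (g : G) (v : TangentSpace 𝓘(ℝ, E) g) : ℝ :=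
  ℓ (mfderiv 𝓘(ℝ, E) 𝓘(ℝ, E) (fun h : G => h * g⁻¹) g v)

/-- The fibre derivative `𝔽L(v_g) ∈ T_g^*G`. -/
def fibreDeriv (ℓ : E → ℝ) (g : G) (v : TangentSpace 𝓘(ℝ, E) g) :
    TangentSpace 𝓘(ℝ, E) g →L[ℝ] ℝ :=
  (fderiv ℝ (fun w : E => lagrangian ℓ g w) v : E →L[ℝ] ℝ)

/-- The momentum map `⟨J_{L,δ}(v_g), ξ⟩ = ⟨𝔽L(v_g), ξ_G(g)⟩ - δ_ξ(g)`. -/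
def momentum (ℓ : E → ℝ) (δ : G → E →L[ℝ] ℝ) (g : G) (v : TangentSpace 𝓘(ℝ, E) g) :
    E →L[ℝ] ℝ :=
  (fibreDeriv ℓ g v).comp (fundMap g) - δ g

/-- `G`-regularity: every map `ξ ↦ J_{L,δ}(v_g + ξ_G(g))` is a diffeomorphism `𝔤 → 𝔤^*`. -/
def IsGRegular (ℓ : E → ℝ) (δ : G → E →L[ℝ] ℝ) : Prop :=
  ∀ (g : G) (v : TangentSpace 𝓘(ℝ, E) g),
    ∃ Φ : Diffeomorph 𝓘(ℝ, E) 𝓘(ℝ, E →L[ℝ] ℝ) E (E →L[ℝ] ℝ) ∞,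
      ∀ ξ : E, Φ ξ = momentum ℓ δ g (v + fundField ξ g)

/-- `Lt` is the Routhian on `G/G_μ` (`π` the projection): the quotient of the restriction to
`J_{L,δ}⁻¹(μ)` of `L - ⟨μ + δ, 𝓐⟩`. -/
def IsRouthian {M : Type*} (ℓ : E → ℝ) (δ : G → E →L[ℝ] ℝ) (μ : E →L[ℝ] ℝ) (π : G → M)
    (Lt : M → ℝ) : Prop :=
  ∀ (g : G) (v : TangentSpace 𝓘(ℝ, E) g), momentum ℓ δ g v = μ →
    Lt (π g) = lagrangian ℓ g v - (μ + δ g) (maurerCartan g v)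

/-- The Euler–Lagrange equations at time `t` of a magnetic Lagrangian system whose configuration
manifold `M` is a bundle over a point, with Lagrangian `Lt : M → ℝ` and magnetic form `Ω`, for a
curve `c` in `M`: `i_{ċ} Ω = d Lt`. -/
def SolvesEulerLagrangeAt {F : Type*} [NormedAddCommGroup F] [NormedSpace ℝ F]
    {M : Type*} [TopologicalSpace M] [ChartedSpace F M]
    (Lt : M → ℝ) (Ω : DiffForm F M 2) (c : ℝ → M) (t : ℝ) : Prop :=
  ∀ w : TangentSpace 𝓘(ℝ, F) (c t),
    Ω (c t) ![mfderiv 𝓘(ℝ, ℝ) 𝓘(ℝ, F) c t (1 : ℝ), w] =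
      mfderiv 𝓘(ℝ, F) 𝓘(ℝ, ℝ) Lt (c t) w

end Lagrangian

end RouthLie

end

/-! Inversion turns the affine right action into the left action `leftAffine`. Its orbit map f(g) =
`leftAffine δ g μ` is equivariant, so it has constant rank. The constant rank theorem yields a slice
for the isotropy group near the identity; left translates of the slice are the charts of G/G_μ, and
f descends to the immersion j.

All that is needed about δ rests on `cocycle_eq`: right invariance of B makes the derivative in p of
δ(p g⁻¹) - Ad^*_{g⁻¹} δ(p) vanish, so on a connected group this expression does not depend on p.
Taking p = h⁻¹ gives the cocycle identity, hence an action. Taking p = g gives ν + δ(e) =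
Ad^*_{g⁻¹}(μ + δ(g)) with ν = f(g), which links the affine orbit to the shifted momentum μ + δ.

The central computation is `shiftedForm_rightMap`: B + d⟨μ + δ, 𝓐⟩ evaluated on (ξg, ηg) equals
⟨Tf(ξg), η⟩. Hence the form sees a vector only through Tf, whose kernel is that of Tπ. So the form
descends, is nondegenerate and is given by the Kirillov–Kostant–Souriau formula; smoothness and
closedness pass down through local lifts of π. The computation needs the Maurer–Cartan structure
equation, obtained from the mixed second derivative of multiplication at the identity
(`lieBr_eq_mulHess`, `fderiv_mcChart_one`).

For the dynamics, `momentum_eq_iff` says that ξg has momentum μ exactly when 𝔽ℓ(ξ) = ν + δ(e). The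
Routhian is therefore minus the Legendre transform of ℓ at ν + δ(e), and for δ(e) = 0 its
differential is w ↦ -⟨w, χ(ν)⟩. Skewness of (ξ, η) ↦ ⟨-ad^*_ξ ν + i_ξ Σ_δ, η⟩ turns the
Euler–Lagrange equation into the stated one. -/

noncomputable section

namespace RouthLie

/-! ### Derivatives of maps between manifolds, typed on the model spaces. -/

section TangentMaps

variable {F : Type*} [NormedAddCommGroup F] [NormedSpace ℝ F]
variable {F' : Type*} [NormedAddCommGroup F'] [NormedSpace ℝ F']
variable {F'' : Type*} [NormedAddCommGroup F''] [NormedSpace ℝ F'']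
variable {M : Type*} [TopologicalSpace M] [ChartedSpace F M]
variable {M' : Type*} [TopologicalSpace M'] [ChartedSpace F' M']
variable {M'' : Type*} [TopologicalSpace M''] [ChartedSpace F'' M'']

variable (F F') in
/-- The derivative of a map between manifolds, as a map between the model spaces. -/
def tderiv (f : M → M') (x : M) : F →L[ℝ] F' := mfderiv 𝓘(ℝ, F) 𝓘(ℝ, F') f x

theorem tderiv_eq_fderiv (f : F → F') (x : F) : tderiv F F' f x = fderiv ℝ f x :=
  mfderiv_eq_fderiv

theorem tderiv_comp {g : M' → M''} {f : M → M'} {x : M}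
    (hg : MDifferentiableAt 𝓘(ℝ, F') 𝓘(ℝ, F'') g (f x))
    (hf : MDifferentiableAt 𝓘(ℝ, F) 𝓘(ℝ, F') f x) :
    tderiv F F'' (fun y => g (f y)) x = (tderiv F' F'' g (f x)).comp (tderiv F F' f x) :=
  mfderiv_comp x hg hf

/-- No differentiability is assumed: where it fails, both derivatives take the default value zero.
-/
theorem tderiv_congr {f g : M → M'} {x : M} (h : f =ᶠ[nhds x] g) :
    tderiv F F' f x = tderiv F F' g x := by
  have H : ∀ L : F →L[ℝ] F', HasMFDerivAt 𝓘(ℝ, F) 𝓘(ℝ, F') f x L ↔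
      HasMFDerivAt 𝓘(ℝ, F) 𝓘(ℝ, F') g x L :=
    fun L => ⟨fun H => H.congr_of_eventuallyEq h.symm, fun H => H.congr_of_eventuallyEq h⟩
  by_cases hf : MDifferentiableAt 𝓘(ℝ, F) 𝓘(ℝ, F') f x
  · exact (((H _).1 hf.hasMFDerivAt).mfderiv).symm
  · have hg : ¬ MDifferentiableAt 𝓘(ℝ, F) 𝓘(ℝ, F') g x :=
      fun hg => hf ((H _).2 hg.hasMFDerivAt).mdifferentiableAt
    exact (mfderiv_zero_of_not_mdifferentiableAt hf).trans
      (mfderiv_zero_of_not_mdifferentiableAt hg).symm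

theorem tderiv_id (x : M) : tderiv F F (fun y : M => y) x = ContinuousLinearMap.id ℝ F :=
  mfderiv_id

theorem _root_.ContMDiffAt.mdiffAt {f : M → M'} {x : M}
    (hf : ContMDiffAt 𝓘(ℝ, F) 𝓘(ℝ, F') ∞ f x) : MDifferentiableAt 𝓘(ℝ, F) 𝓘(ℝ, F') f x :=
  hf.mdifferentiableAt (by simp)

theorem _root_.ContMDiff.mdiffAt {f : M → M'} (hf : ContMDiff 𝓘(ℝ, F) 𝓘(ℝ, F') ∞ f) (x : M) :
    MDifferentiableAt 𝓘(ℝ, F) 𝓘(ℝ, F') f x :=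
  (hf x).mdiffAt

section Charts

variable [IsManifold 𝓘(ℝ, F) ∞ M]

theorem contMDiffAt_chart {x y : M} (hy : y ∈ (extChartAt 𝓘(ℝ, F) x).source) :
    ContMDiffAt 𝓘(ℝ, F) 𝓘(ℝ, F) ∞ (extChartAt 𝓘(ℝ, F) x) y :=
  contMDiffAt_extChartAt' (by rwa [extChartAt_source] at hy)

theorem contMDiffAt_chart_symm {x : M} {y : F} (hy : y ∈ (extChartAt 𝓘(ℝ, F) x).target) :
    ContMDiffAt 𝓘(ℝ, F) 𝓘(ℝ, F) ∞ (extChartAt 𝓘(ℝ, F) x).symm y :=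
  (contMDiffOn_extChartAt_symm x).contMDiffAt
    ((isOpen_extChartAt_target (I := 𝓘(ℝ, F)) x).mem_nhds hy)

theorem tderiv_chart_comp_symm {x : M} {y : F} (hy : y ∈ (extChartAt 𝓘(ℝ, F) x).target) :
    (tderiv F F (extChartAt 𝓘(ℝ, F) x) ((extChartAt 𝓘(ℝ, F) x).symm y)).comp
      (tderiv F F (extChartAt 𝓘(ℝ, F) x).symm y) = ContinuousLinearMap.id ℝ F := by
  rw [← tderiv_comp (contMDiffAt_chart ((extChartAt 𝓘(ℝ, F) x).map_target hy)).mdiffAt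
    (contMDiffAt_chart_symm hy).mdiffAt, ← tderiv_id y]
  refine tderiv_congr ?_
  filter_upwards [(isOpen_extChartAt_target (I := 𝓘(ℝ, F)) x).mem_nhds hy] with z hz
  exact (extChartAt 𝓘(ℝ, F) x).right_inv hz

theorem tderiv_symm_comp_chart {x y : M} (hy : y ∈ (extChartAt 𝓘(ℝ, F) x).source) :
    (tderiv F F (extChartAt 𝓘(ℝ, F) x).symm (extChartAt 𝓘(ℝ, F) x y)).comp
      (tderiv F F (extChartAt 𝓘(ℝ, F) x) y) = ContinuousLinearMap.id ℝ F := by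
  rw [← tderiv_comp (contMDiffAt_chart_symm ((extChartAt 𝓘(ℝ, F) x).map_source hy)).mdiffAt
    (contMDiffAt_chart hy).mdiffAt, ← tderiv_id y]
  refine tderiv_congr ?_
  filter_upwards [(isOpen_extChartAt_source (I := 𝓘(ℝ, F)) x).mem_nhds hy] with z hz
  exact (extChartAt 𝓘(ℝ, F) x).left_inv hz

/-- The tangent space at x is identified with the model space through the preferred chart at x, so
this chart has identity derivative at its centre. Most later computations are arranged to happen at
such centres. -/
theorem tderiv_chart_self (x : M) :
    tderiv F F (extChartAt 𝓘(ℝ, F) x) x = ContinuousLinearMap.id ℝ F := by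
  have : IsManifold 𝓘(ℝ, F) 1 M := IsManifold.of_le (n := ∞) (by simp)
  exact mfderiv_extChartAt_self

theorem tderiv_chart_symm_self (x : M) :
    tderiv F F (extChartAt 𝓘(ℝ, F) x).symm (extChartAt 𝓘(ℝ, F) x x) = ContinuousLinearMap.id ℝ F := by
  have := tderiv_symm_comp_chart (F := F) (mem_extChartAt_source (I := 𝓘(ℝ, F)) x)
  rwa [tderiv_chart_self, ContinuousLinearMap.comp_id] at this

end Charts

end TangentMaps

/-! ### Smooth families of alternating forms on normed spaces. -/

section FormCalculus

variable {P : Type*} [NormedAddCommGroup P] [NormedSpace ℝ P]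
variable {F : Type*} [NormedAddCommGroup F] [NormedSpace ℝ F]
variable {F₀ : Type*} [NormedAddCommGroup F₀] [NormedSpace ℝ F₀]

theorem two_le_infty : minSmoothness ℝ 2 ≤ ∞ := by
  rw [minSmoothness_of_isRCLikeNormedField]
  exact WithTop.coe_le_coe.2 le_top

theorem contDiff_alternating_apply {k : ℕ} :
    ContDiff ℝ ∞ fun p : (F [⋀^Fin k]→L[ℝ] ℝ) × (Fin k → F) => p.1 p.2 := by
  refine contDiff_iff_contDiffAt.2 fun p => AnalyticAt.contDiffAt ?_
  exact ContinuousLinearMap.analyticAt_uncurry_of_multilinear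
    (ContinuousAlternatingMap.toContinuousMultilinearMapCLM ℝ :
      (F [⋀^Fin k]→L[ℝ] ℝ) →L[ℝ] ContinuousMultilinearMap ℝ (fun _ : Fin k => F) ℝ)

/-- An alternating map is determined by its values on tuples of basis vectors, and an injective
linear map has a linear left inverse. Smoothness of a form can thus be tested on fixed vectors. -/
theorem exists_linear_reconstruction_alternating [FiniteDimensional ℝ F] (k : ℕ) :
    ∃ (ι : Type) (_ : Fintype ι) (v : ι → Fin k → F)
      (L : (ι → ℝ) →L[ℝ] (F [⋀^Fin k]→L[ℝ] ℝ)),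
      ∀ α : F [⋀^Fin k]→L[ℝ] ℝ, L (fun i => α (v i)) = α := by
  let b := Module.finBasis ℝ F
  let v : (Fin k → Fin (Module.finrank ℝ F)) → Fin k → F := fun r i => b (r i)
  let ev : (F [⋀^Fin k]→L[ℝ] ℝ) →ₗ[ℝ] ((Fin k → Fin (Module.finrank ℝ F)) → ℝ) :=
    { toFun := fun α r => α (v r)
      map_add' := fun _ _ => rfl
      map_smul' := fun _ _ => rfl }
  have hinj : Function.Injective ev := by
    intro α α' h
    apply ContinuousAlternatingMap.toContinuousMultilinearMap_injective
    apply ContinuousMultilinearMap.toMultilinearMap_injective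
    refine Module.Basis.ext_multilinear (fun _ => b) fun r => ?_
    exact congrFun h r
  obtain ⟨L, hL⟩ := ev.exists_leftInverse_of_injective (LinearMap.ker_eq_bot.2 hinj)
  exact ⟨_, inferInstance, v, LinearMap.toContinuousLinearMap L, fun α => LinearMap.congr_fun hL α⟩

theorem contDiffAt_alternating_of_apply [FiniteDimensional ℝ F] {k : ℕ}
    {α : P → F [⋀^Fin k]→L[ℝ] ℝ} {p : P}
    (h : ∀ v : Fin k → F, ContDiffAt ℝ ∞ (fun q => α q v) p) : ContDiffAt ℝ ∞ α p := by
  obtain ⟨ι, _, v, L, hL⟩ := exists_linear_reconstruction_alternating (F := F) k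
  have : α = fun q => L (fun i => α q (v i)) := by ext1 q; exact (hL _).symm
  rw [this]
  exact L.contDiff.contDiffAt.comp p (contDiffAt_pi.2 fun i => h (v i))

theorem contDiffAt_compContinuousLinearMap [FiniteDimensional ℝ F₀] {k : ℕ}
    {α : P → F [⋀^Fin k]→L[ℝ] ℝ} {A : P → F₀ →L[ℝ] F} {p : P}
    (hα : ContDiffAt ℝ ∞ α p) (hA : ContDiffAt ℝ ∞ A p) :
    ContDiffAt ℝ ∞ (fun q => (α q).compContinuousLinearMap (A q)) p := by
  refine contDiffAt_alternating_of_apply fun v => ?_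
  exact contDiff_alternating_apply.contDiffAt.comp p
    (hα.prodMk (contDiffAt_pi.2 fun i => hA.clm_apply contDiffAt_const))

end FormCalculus

/-! ### Forms on manifolds: pull-back, exterior derivative, descent. -/

section ManifoldForms

variable {F : Type*} [NormedAddCommGroup F] [NormedSpace ℝ F]
variable {F₀ : Type*} [NormedAddCommGroup F₀] [NormedSpace ℝ F₀]
variable {M : Type*} [TopologicalSpace M] [ChartedSpace F M]
variable {F' : Type*} [NormedAddCommGroup F'] [NormedSpace ℝ F']
variable {M' : Type*} [TopologicalSpace M'] [ChartedSpace F' M']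

/-- The value of a form at a point, as an alternating map on the model space. -/
def DiffForm.at {k : ℕ} (Ω : DiffForm F M k) (x : M) : F [⋀^Fin k]→L[ℝ] ℝ := Ω x

/-- The pull-back of a form along a parametrization. -/
def DiffForm.along {k : ℕ} (Ω : DiffForm F M k) (h : F₀ → M) (y : F₀) : F₀ [⋀^Fin k]→L[ℝ] ℝ :=
  (Ω.at (h y)).compContinuousLinearMap (tderiv F₀ F h y)

theorem DiffForm.inChart_eq_along {k : ℕ} (Ω : DiffForm F M k) (x : M) :
    Ω.inChart x = Ω.along (extChartAt 𝓘(ℝ, F) x).symm := rfl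

theorem DiffForm.pullback_at {k : ℕ} (f : M → M') (Ω : DiffForm F' M' k) (x : M) :
    (Ω.pullback (F := F) f).at x = (Ω.at (f x)).compContinuousLinearMap (tderiv F F' f x) := rfl

theorem DiffForm.d_at {k : ℕ} (Ω : DiffForm F M k) (x : M) :
    Ω.d.at x = (extDeriv (Ω.along (extChartAt 𝓘(ℝ, F) x).symm)
      (extChartAt 𝓘(ℝ, F) x x)).compContinuousLinearMap (tderiv F F (extChartAt 𝓘(ℝ, F) x) x) := rfl

theorem DiffForm.eq_of_at {k : ℕ} {Ω Ω' : DiffForm F M k} (h : ∀ x, Ω.at x = Ω'.at x) : Ω = Ω' :=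
  funext h

theorem DiffForm.IsSmooth.inChart_contDiffAt {k : ℕ} {Ω : DiffForm F M k} (hΩ : Ω.IsSmooth)
    {x : M} {y : F} (hy : y ∈ (extChartAt 𝓘(ℝ, F) x).target) : ContDiffAt ℝ ∞ (Ω.inChart x) y :=
  (hΩ x).contDiffAt ((isOpen_extChartAt_target x).mem_nhds hy)

theorem DiffForm.IsSmooth.add {k : ℕ} {Ω Ω' : DiffForm F M k} (hΩ : Ω.IsSmooth)
    (hΩ' : Ω'.IsSmooth) : (Ω + Ω').IsSmooth :=
  fun x => (hΩ x).add (hΩ' x)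

theorem DiffForm.IsSmooth.d_add {k : ℕ} {Ω Ω' : DiffForm F M k} (hΩ : Ω.IsSmooth)
    (hΩ' : Ω'.IsSmooth) : (Ω + Ω').d = Ω.d + Ω'.d := by
  refine DiffForm.eq_of_at fun x => ?_
  have hx := mem_extChartAt_target (I := 𝓘(ℝ, F)) x
  have : extDeriv ((Ω + Ω').inChart x) (extChartAt 𝓘(ℝ, F) x x) =
      extDeriv (Ω.inChart x) (extChartAt 𝓘(ℝ, F) x x) +
        extDeriv (Ω'.inChart x) (extChartAt 𝓘(ℝ, F) x x) :=
    extDeriv_add ((hΩ.inChart_contDiffAt hx).differentiableAt (by simp))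
      ((hΩ'.inChart_contDiffAt hx).differentiableAt (by simp))
  rw [DiffForm.d_at, ← DiffForm.inChart_eq_along, this]
  rfl

variable [IsManifold 𝓘(ℝ, F) ∞ M]

/-- Inserting the chart and its inverse factors h through a map between normed spaces, where the
flat calculus of forms applies. This holds only as long as h stays in the chart domain. -/
theorem DiffForm.along_eventuallyEq {k : ℕ} (Ω : DiffForm F M k) {h : F₀ → M} {y : F₀} {x : M}
    (hh : ContMDiffAt 𝓘(ℝ, F₀) 𝓘(ℝ, F) ∞ h y) (hx : h y ∈ (extChartAt 𝓘(ℝ, F) x).source) :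
    Ω.along h =ᶠ[nhds y] fun z =>
      (Ω.inChart x (extChartAt 𝓘(ℝ, F) x (h z))).compContinuousLinearMap
        (fderiv ℝ (fun z => extChartAt 𝓘(ℝ, F) x (h z)) z) := by
  have h1 : ∀ᶠ z in nhds y, h z ∈ (extChartAt 𝓘(ℝ, F) x).source :=
    hh.continuousAt.eventually ((isOpen_extChartAt_source x).mem_nhds hx)
  -- C^∞ at a point yields only finite regularity on a neighbourhood; C^1 suffices here.
  have h2 : ∀ᶠ z in nhds y, MDifferentiableAt 𝓘(ℝ, F₀) 𝓘(ℝ, F) h z := by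
    have : ContMDiffAt 𝓘(ℝ, F₀) 𝓘(ℝ, F) 1 h y := hh.of_le (by simp)
    obtain ⟨u, hu, hu'⟩ := (contMDiffAt_iff_contMDiffOn_nhds (by simp)).1 this
    filter_upwards [eventually_mem_nhds_iff.2 hu] with z hz
    exact (hu'.contMDiffAt hz).mdifferentiableAt (by simp)
  filter_upwards [h1, h2] with z hz hdz
  have hs := (extChartAt 𝓘(ℝ, F) x).map_source hz
  rw [← tderiv_eq_fderiv, tderiv_comp (contMDiffAt_chart hz).mdiffAt hdz]
  have hcomp := tderiv_symm_comp_chart hz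
  ext v
  simp only [DiffForm.along, DiffForm.inChart_eq_along,
    ContinuousAlternatingMap.compContinuousLinearMap_apply, Function.comp_def,
    (extChartAt 𝓘(ℝ, F) x).left_inv hz]
  congr 1
  ext1 i
  exact (DFunLike.congr_fun hcomp (tderiv F₀ F h z (v i))).symm

theorem contDiffAt_chart_comp {h : F₀ → M} {y : F₀} {x : M}
    (hh : ContMDiffAt 𝓘(ℝ, F₀) 𝓘(ℝ, F) ∞ h y) (hx : h y ∈ (extChartAt 𝓘(ℝ, F) x).source) :
    ContDiffAt ℝ ∞ (fun z => extChartAt 𝓘(ℝ, F) x (h z)) y :=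
  ((contMDiffAt_chart hx).comp y hh).contDiffAt

theorem DiffForm.IsSmooth.along_contDiffAt [FiniteDimensional ℝ F₀] {k : ℕ} {Ω : DiffForm F M k}
    (hΩ : Ω.IsSmooth) {h : F₀ → M} {y : F₀} (hh : ContMDiffAt 𝓘(ℝ, F₀) 𝓘(ℝ, F) ∞ h y) :
    ContDiffAt ℝ ∞ (Ω.along h) y := by
  have hx := mem_extChartAt_source (I := 𝓘(ℝ, F)) (h y)
  refine ContDiffAt.congr_of_eventuallyEq ?_ (Ω.along_eventuallyEq hh hx)
  have hk := contDiffAt_chart_comp hh hx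
  refine contDiffAt_compContinuousLinearMap ?_ (hk.fderiv_right (m := ∞) (by simp))
  exact (hΩ.inChart_contDiffAt ((extChartAt 𝓘(ℝ, F) (h y)).map_source hx)).comp y hk

/-- Naturality of d. Since `DiffForm.d` uses a different chart at each point, this is also what
makes it chart independent. -/
theorem DiffForm.IsSmooth.extDeriv_along {k : ℕ} {Ω : DiffForm F M k}
    (hΩ : Ω.IsSmooth) {h : F₀ → M} {y : F₀} (hh : ContMDiffAt 𝓘(ℝ, F₀) 𝓘(ℝ, F) ∞ h y) :
    extDeriv (Ω.along h) y = Ω.d.along h y := by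
  have hx := mem_extChartAt_source (I := 𝓘(ℝ, F)) (h y)
  have hk := contDiffAt_chart_comp hh hx
  rw [(Ω.along_eventuallyEq hh hx).extDeriv_eq,
    extDeriv_pullback (f := fun z => extChartAt 𝓘(ℝ, F) (h y) (h z)) ((hΩ.inChart_contDiffAt
      ((extChartAt 𝓘(ℝ, F) (h y)).map_source hx)).differentiableAt (by simp)) hk two_le_infty,
    ← tderiv_eq_fderiv, tderiv_comp (contMDiffAt_chart hx).mdiffAt hh.mdiffAt]
  rfl

theorem DiffForm.IsSmooth.d_inChart {k : ℕ} {Ω : DiffForm F M k} (hΩ : Ω.IsSmooth) {x : M} {y : F}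
    (hy : y ∈ (extChartAt 𝓘(ℝ, F) x).target) : Ω.d.inChart x y = extDeriv (Ω.inChart x) y :=
  (hΩ.extDeriv_along (contMDiffAt_chart_symm hy)).symm

theorem contDiffAt_extDeriv {k : ℕ} {α : F → F [⋀^Fin k]→L[ℝ] ℝ} {y : F}
    (h : ContDiffAt ℝ ∞ α y) : ContDiffAt ℝ ∞ (extDeriv α) y := by
  have h1 : ContDiffAt ℝ ∞ (fderiv ℝ α) y := h.fderiv_right (by simp)
  exact (ContinuousAlternatingMap.alternatizeUncurryFinCLM (n := k) ℝ F ℝ).contDiff.contDiffAt.comp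
    y h1

theorem DiffForm.IsSmooth.d {k : ℕ} {Ω : DiffForm F M k} (hΩ : Ω.IsSmooth) : Ω.d.IsSmooth :=
  fun _ => ContDiffOn.congr (fun _ hy =>
    (contDiffAt_extDeriv (hΩ.inChart_contDiffAt hy)).contDiffWithinAt) fun _ hy => hΩ.d_inChart hy

theorem DiffForm.IsSmooth.d_d {k : ℕ} {Ω : DiffForm F M k} (hΩ : Ω.IsSmooth) : Ω.d.d = 0 := by
  refine DiffForm.eq_of_at fun x => ?_
  have hx := mem_extChartAt_target (I := 𝓘(ℝ, F)) x
  have h1 : Ω.d.inChart x =ᶠ[nhds (extChartAt 𝓘(ℝ, F) x x)] extDeriv (Ω.inChart x) := by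
    filter_upwards [(isOpen_extChartAt_target (I := 𝓘(ℝ, F)) x).mem_nhds hx] with y hy
    exact hΩ.d_inChart hy
  rw [DiffForm.d_at, ← DiffForm.inChart_eq_along, h1.extDeriv_eq,
    extDeriv_extDeriv_apply (hΩ.inChart_contDiffAt hx) two_le_infty]
  rfl

/-- If the inverse charts of `N` lift smoothly through `π`, then a form on `N` whose pull-back
along `π` is smooth and closed is itself smooth and closed. -/
theorem DiffForm.smooth_closed_of_pullback {N : Type*} [TopologicalSpace N] [ChartedSpace F₀ N]
    [FiniteDimensional ℝ F₀] [IsManifold 𝓘(ℝ, F₀) ∞ N] {k : ℕ} {π : M → N}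
    (hπ : ContMDiff 𝓘(ℝ, F) 𝓘(ℝ, F₀) ∞ π)
    (hs : ∀ x : N, ∃ s : F₀ → M, ∀ y ∈ (extChartAt 𝓘(ℝ, F₀) x).target,
      ContMDiffAt 𝓘(ℝ, F₀) 𝓘(ℝ, F) ∞ s y ∧ (extChartAt 𝓘(ℝ, F₀) x).symm y = π (s y))
    (Ω : DiffForm F₀ N k) (hΩ : (Ω.pullback (F := F) π).IsSmooth)
    (hd : (Ω.pullback (F := F) π).d = 0) : Ω.IsSmooth ∧ Ω.d = 0 := by
  -- The inverse chart is π ∘ s, so the coordinate expression of Ω is the pull-back of π^*Ω along s.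
  have key : ∀ x : N, ∃ s : F₀ → M, ∀ y ∈ (extChartAt 𝓘(ℝ, F₀) x).target,
      ContMDiffAt 𝓘(ℝ, F₀) 𝓘(ℝ, F) ∞ s y ∧
      Ω.inChart x y = (Ω.pullback (F := F) π).along s y := by
    intro x
    obtain ⟨s, hs⟩ := hs x
    refine ⟨s, fun y hy => ⟨(hs y hy).1, ?_⟩⟩
    have h1 : tderiv F₀ F₀ (extChartAt 𝓘(ℝ, F₀) x).symm y = (tderiv F F₀ π (s y)).comp (tderiv F₀ F s y) := by
      rw [← tderiv_comp (hπ.mdiffAt _) (hs y hy).1.mdiffAt]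
      refine tderiv_congr ?_
      filter_upwards [(isOpen_extChartAt_target (I := 𝓘(ℝ, F₀)) x).mem_nhds hy] with z hz
      exact (hs z hz).2
    rw [DiffForm.inChart_eq_along, DiffForm.along, DiffForm.along, h1, (hs y hy).2,
      DiffForm.pullback_at]
    rfl
  constructor
  · intro x
    obtain ⟨s, hs⟩ := key x
    exact ContDiffOn.congr (fun y hy => (hΩ.along_contDiffAt (hs y hy).1).contDiffWithinAt)
      fun y hy => (hs y hy).2
  · refine DiffForm.eq_of_at fun x => ?_
    obtain ⟨s, hs⟩ := key x
    have hx := mem_extChartAt_target (I := 𝓘(ℝ, F₀)) x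
    have h1 : Ω.inChart x =ᶠ[nhds (extChartAt 𝓘(ℝ, F₀) x x)] (Ω.pullback (F := F) π).along s := by
      filter_upwards [(isOpen_extChartAt_target (I := 𝓘(ℝ, F₀)) x).mem_nhds hx] with y hy
      exact (hs y hy).2
    rw [DiffForm.d_at, ← DiffForm.inChart_eq_along, h1.extDeriv_eq,
      hΩ.extDeriv_along (hs _ hx).1, hd]
    rfl

end ManifoldForms

/-! ### Inverse function theorem and constant rank factorization. -/

section ConstantRank

variable {E : Type*} [NormedAddCommGroup E] [NormedSpace ℝ E] [CompleteSpace E]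
variable {W : Type*} [NormedAddCommGroup W] [NormedSpace ℝ W]

/-- The inverse function theorem on an open set, with smooth inverse on the whole target. -/
theorem exists_smooth_local_inverse {f : E → W} {S : Set E} (hS : IsOpen S)
    (hf : ∀ y ∈ S, ContDiffAt ℝ ∞ f y) {y₀ : E} (hy₀ : y₀ ∈ S) (L : E ≃L[ℝ] W)
    (hL : fderiv ℝ f y₀ = (L : E →L[ℝ] W)) :
    ∃ e : OpenPartialHomeomorph E W, y₀ ∈ e.source ∧ e.source ⊆ S ∧ (∀ y, e y = f y) ∧
      ∀ z ∈ e.target, ContDiffAt ℝ ∞ e.symm z := by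
  have hd : HasFDerivAt f (L : E →L[ℝ] W) y₀ := by
    rw [← hL]; exact ((hf y₀ hy₀).differentiableAt (by simp)).hasFDerivAt
  let e₀ := (hf y₀ hy₀).toOpenPartialHomeomorph f hd (by simp)
  -- Invertible maps form an open set, so R is open. Restricting to R makes the inverse smooth at
  -- every point of the target, not only at the image of `y₀`.
  let R : Set E := {y ∈ S | fderiv ℝ f y ∈ Set.range ((↑) : (E ≃L[ℝ] W) → E →L[ℝ] W)}
  have hR : IsOpen R := by
    have hc : ContinuousOn (fderiv ℝ f) S := fun y hy =>
      ((hf y hy).fderiv_right (m := ∞) (by simp)).continuousAt.continuousWithinAt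
    exact hc.isOpen_inter_preimage hS ContinuousLinearEquiv.isOpen
  have hyR : y₀ ∈ R := ⟨hy₀, L, hL.symm⟩
  refine ⟨e₀.restrOpen R hR, ⟨(hf y₀ hy₀).mem_toOpenPartialHomeomorph_source hd (by simp), hyR⟩,
    fun y hy => hy.2.1, fun y => rfl, fun z hz => ?_⟩
  have hz' := (e₀.restrOpen R hR).map_target hz
  obtain ⟨L', hL'⟩ := hz'.2.2
  have hs := hf _ hz'.2.1
  refine (e₀.restrOpen R hR).contDiffAt_symm (f₀' := L') hz ?_ hs
  rw [hL']
  exact (hs.differentiableAt (by simp)).hasFDerivAt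

variable [FiniteDimensional ℝ E] [FiniteDimensional ℝ W]

/-- A local form of the constant rank theorem: if the rank of `f` does not exceed the dimension of
the range `V` of the derivative at `y₀`, then `f` factors near `y₀` through a projection to `V`. -/
theorem exists_local_factorization {f : E → W} {S : Set E} (hS : IsOpen S)
    (hf : ∀ y ∈ S, ContDiffAt ℝ ∞ f y) {y₀ : E} (hy₀ : y₀ ∈ S) (V : Submodule ℝ W)
    (hV : LinearMap.range (fderiv ℝ f y₀ : E →ₗ[ℝ] W) = V)
    (hrank : ∀ y ∈ S, Module.finrank ℝ (LinearMap.range (fderiv ℝ f y : E →ₗ[ℝ] W)) ≤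
      Module.finrank ℝ V)
    (p : W →L[ℝ] V) (hp : ∀ v : V, p v = v) :
    ∃ (A : Set V) (U : Set E) (s : V → E), IsOpen A ∧ IsOpen U ∧ y₀ ∈ U ∧ U ⊆ S ∧
      (∀ a ∈ A, ContDiffAt ℝ ∞ s a) ∧ (∀ a ∈ A, s a ∈ U) ∧ (∀ a ∈ A, p (f (s a)) = a) ∧
      (∀ y ∈ U, p (f y) ∈ A) ∧ ∀ y ∈ U, f (s (p (f y))) = f y := by
  set f' : E →L[ℝ] W := fderiv ℝ f y₀ with hf'
  let q : E →L[ℝ] V := p.comp f'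
  have hqsurj : Function.Surjective q := by
    intro v
    have : (v : W) ∈ LinearMap.range (f' : E →ₗ[ℝ] W) := by rw [hV]; exact v.2
    obtain ⟨x, hx⟩ := this
    exact ⟨x, by change p (f' x) = v; rw [show f' x = v from hx, hp]⟩
  let K : Submodule ℝ E := LinearMap.ker (q : E →ₗ[ℝ] V)
  obtain ⟨r₀, hr₀⟩ := K.subtype.exists_leftInverse_of_injective (by simp)
  let r : E →L[ℝ] K := LinearMap.toContinuousLinearMap r₀
  have hr : ∀ k : K, r k = k := fun k => LinearMap.congr_fun hr₀ k
  let Lc : E →L[ℝ] V × K := q.prod r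
  have hker : LinearMap.ker (Lc : E →ₗ[ℝ] V × K) = ⊥ := by
    rw [LinearMap.ker_eq_bot']
    intro x hx
    have h1 : q x = 0 := congrArg Prod.fst hx
    have h2 : r x = 0 := congrArg Prod.snd hx
    have h3 := hr ⟨x, h1⟩
    rw [show r ((⟨x, h1⟩ : K) : E) = 0 from h2] at h3
    exact (congrArg Subtype.val h3).symm
  have hrange : LinearMap.range (Lc : E →ₗ[ℝ] V × K) = ⊤ := by
    rw [LinearMap.range_eq_top]
    rintro ⟨v, k⟩
    obtain ⟨x, hx⟩ := hqsurj v
    refine ⟨x + ((k - r x : K) : E), Prod.ext ?_ ?_⟩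
    · change q (x + ((k - r x : K) : E)) = v
      rw [map_add, hx, show q ((k - r x : K) : E) = 0 from (k - r x).2, add_zero]
    · change r (x + ((k - r x : K) : E)) = k
      rw [map_add, hr]; abel
  let L : E ≃L[ℝ] V × K := ContinuousLinearEquiv.ofBijective Lc hker hrange
  -- Straightening coordinates: the derivative at `y₀` is (q, r), invertible because q is onto V and
  -- r projects onto its kernel.
  let Θ : E → V × K := fun y => (p (f y), r y)
  have hΘ : ∀ y ∈ S, ContDiffAt ℝ ∞ Θ y := fun y hy =>
    (p.contDiff.contDiffAt.comp y (hf y hy)).prodMk r.contDiff.contDiffAt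
  have hpf : ∀ y ∈ S, HasFDerivAt (fun y => p (f y)) (p.comp (fderiv ℝ f y)) y := fun y hy =>
    p.hasFDerivAt.comp y ((hf y hy).differentiableAt (by simp)).hasFDerivAt
  have hΘ' : fderiv ℝ Θ y₀ = (L : E →L[ℝ] V × K) :=
    ((hpf y₀ hy₀).prodMk r.hasFDerivAt).fderiv
  obtain ⟨e, he₀, heS, heΘ, hes⟩ := exists_smooth_local_inverse hS hΘ hy₀ L hΘ'
  obtain ⟨ε, hε, hball⟩ := Metric.isOpen_iff.1 e.open_target (Θ y₀)
    (by rw [← heΘ]; exact e.map_source he₀)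
  let a₀ := (Θ y₀).1
  let b₀ := (Θ y₀).2
  have hmem : ∀ a ∈ Metric.ball a₀ ε, ∀ b ∈ Metric.ball b₀ ε, (a, b) ∈ e.target := by
    intro a ha b hb
    apply hball
    rw [← ball_prod_same]
    exact ⟨ha, hb⟩
  have hright : ∀ z ∈ e.target, Θ (e.symm z) = z := fun z hz => by
    rw [← heΘ]; exact e.right_inv hz
  -- In these coordinates f is constant along the K-direction. Its K-derivative is killed by p, and
  -- by the rank bound p is injective on the range of the derivative.
  have hconst : ∀ a ∈ Metric.ball a₀ ε, ∀ b ∈ Metric.ball b₀ ε, ∀ b' ∈ Metric.ball b₀ ε,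
      f (e.symm (a, b)) = f (e.symm (a, b')) := by
    intro a ha b hb b' hb'
    have hder : ∀ c ∈ Metric.ball b₀ ε, HasFDerivAt (fun c => f (e.symm (a, c))) (0 : K →L[ℝ] W) c := by
      intro c hc
      have hz := hmem a ha c hc
      have hyS := heS (e.map_target hz)
      have h1 : HasFDerivAt (fun c => e.symm (a, c))
          ((fderiv ℝ e.symm (a, c)).comp (ContinuousLinearMap.inr ℝ V K)) c :=
        HasFDerivAt.comp c ((hes _ hz).differentiableAt (by simp)).hasFDerivAt
          (hasFDerivAt_prodMk_right a c)
      have h2 := HasFDerivAt.comp c ((hf _ hyS).differentiableAt (by simp)).hasFDerivAt h1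
      have h3 := HasFDerivAt.comp c (hpf _ hyS) h1
      have h4 : HasFDerivAt (fun c => p (f (e.symm (a, c)))) (0 : K →L[ℝ] V) c := by
        refine (hasFDerivAt_const a c).congr_of_eventuallyEq ?_
        filter_upwards [Metric.isOpen_ball.mem_nhds hc] with d hd
        exact congrArg Prod.fst (hright _ (hmem a ha d hd))
      have h5 := h3.unique h4
      -- surjectivity of `p ∘ f'` at the point
      have h6 : Function.Surjective fun x => p (fderiv ℝ f (e.symm (a, c)) x) := by
        intro v
        have g1 : HasFDerivAt (fun z : V × K => p (f (e.symm z)))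
            ((p.comp (fderiv ℝ f (e.symm (a, c)))).comp (fderiv ℝ e.symm (a, c))) (a, c) :=
          HasFDerivAt.comp (a, c) (hpf _ hyS)
            ((hes _ hz).differentiableAt (by simp)).hasFDerivAt
        have g2 : HasFDerivAt (fun z : V × K => p (f (e.symm z)))
            (ContinuousLinearMap.fst ℝ V K) (a, c) := by
          refine hasFDerivAt_fst.congr_of_eventuallyEq ?_
          filter_upwards [e.open_target.mem_nhds hz] with d hd
          exact congrArg Prod.fst (hright _ hd)
        have g3 := DFunLike.congr_fun (g1.unique g2) (v, 0)
        exact ⟨fderiv ℝ e.symm (a, c) (v, 0), g3⟩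
      -- p maps the range onto V and the range has dimension at most that of V, so this surjection
      -- is injective.
      have h7 : Function.Injective
          ((p : W →ₗ[ℝ] V).domRestrict
            (LinearMap.range (fderiv ℝ f (e.symm (a, c)) : E →ₗ[ℝ] W))) := by
        have hs : Function.Surjective ((p : W →ₗ[ℝ] V).domRestrict
            (LinearMap.range (fderiv ℝ f (e.symm (a, c)) : E →ₗ[ℝ] W))) := by
          intro v
          obtain ⟨x, hx⟩ := h6 v
          exact ⟨⟨_, x, rfl⟩, hx⟩
        refine (LinearMap.injective_iff_surjective_of_finrank_eq_finrank ?_).2 hs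
        exact le_antisymm (hrank _ hyS) (LinearMap.finrank_le_finrank_of_surjective hs)
      have hzero : (fderiv ℝ f (e.symm (a, c))).comp
          ((fderiv ℝ e.symm (a, c)).comp (ContinuousLinearMap.inr ℝ V K)) = 0 := by
        ext1 k
        set w := ((fderiv ℝ e.symm (a, c)).comp (ContinuousLinearMap.inr ℝ V K)) k with hw
        have h8 : p (fderiv ℝ f (e.symm (a, c)) w) = 0 := DFunLike.congr_fun h5 k
        have h9 := @h7 ⟨fderiv ℝ f (e.symm (a, c)) w, w, rfl⟩ 0 (h8.trans (map_zero _).symm)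
        exact congrArg Subtype.val h9
      rw [hzero] at h2
      exact h2
    refine (convex_ball b₀ ε).is_const_of_fderivWithin_eq_zero (𝕜 := ℝ)
      (f := fun c => f (e.symm (a, c)))
      (fun c hc => (hder c hc).differentiableAt.differentiableWithinAt) (fun c hc => ?_) hb hb'
    rw [fderivWithin_of_isOpen Metric.isOpen_ball hc]
    exact (hder c hc).fderiv
  have hb₀ : b₀ ∈ Metric.ball b₀ ε := Metric.mem_ball_self hε
  let U : Set E := e.source ∩ e ⁻¹' (Metric.ball a₀ ε ×ˢ Metric.ball b₀ ε)
  have hUS : ∀ a ∈ Metric.ball a₀ ε, ∀ b ∈ Metric.ball b₀ ε, e.symm (a, b) ∈ U := by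
    intro a ha b hb
    refine ⟨e.map_target (hmem a ha b hb), ?_⟩
    rw [Set.mem_preimage, e.right_inv (hmem a ha b hb)]
    exact ⟨ha, hb⟩
  refine ⟨Metric.ball a₀ ε, U, fun a => e.symm (a, b₀), Metric.isOpen_ball,
    e.isOpen_inter_preimage (Metric.isOpen_ball.prod Metric.isOpen_ball), ⟨he₀, ?_⟩,
    fun y hy => heS hy.1, fun a ha => ?_, fun a ha => hUS a ha b₀ hb₀, fun a ha => ?_,
    fun y hy => ?_, fun y hy => ?_⟩
  · rw [Set.mem_preimage, heΘ]
    exact ⟨Metric.mem_ball_self hε, hb₀⟩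
  · exact (hes _ (hmem a ha b₀ hb₀)).comp a (contDiffAt_id.prodMk contDiffAt_const)
  · exact congrArg Prod.fst (hright _ (hmem a ha b₀ hb₀))
  · have := hy.2.1
    rwa [heΘ] at this
  · have h1 := hy.2
    rw [Set.mem_preimage, heΘ] at h1
    have h2 : e.symm (p (f y), r y) = y := by
      have := e.left_inv hy.1
      rwa [heΘ] at this
    exact (hconst _ h1.1 _ hb₀ _ h1.2).trans (by rw [h2])

end ConstantRank

/-! ### The manifold structure on a coset space defined by a slice. -/

section CosetSpace

variable {E : Type*} [NormedAddCommGroup E] [NormedSpace ℝ E]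
variable {V : Type*} [NormedAddCommGroup V] [NormedSpace ℝ V]
variable {G : Type*} [TopologicalSpace G] [ChartedSpace E G] [Group G]

theorem isTopologicalGroup_of_smooth (E : Type*) [NormedAddCommGroup E] [NormedSpace ℝ E]
    (G : Type*) [TopologicalSpace G] [ChartedSpace E G] [Group G] [LieGroup 𝓘(ℝ, E) ∞ G] :
    IsTopologicalGroup G :=
  topologicalGroup_of_lieGroup 𝓘(ℝ, E) ∞

theorem contMDiff_leftMul [LieGroup 𝓘(ℝ, E) ∞ G] (g : G) : ContMDiff 𝓘(ℝ, E) 𝓘(ℝ, E) ∞ fun h : G => g * h :=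
  contMDiff_mul_left

theorem contMDiff_rightMul [LieGroup 𝓘(ℝ, E) ∞ G] (g : G) : ContMDiff 𝓘(ℝ, E) 𝓘(ℝ, E) ∞ fun h : G => h * g :=
  contMDiff_mul_right

/-- A slice for the right action of a subgroup `H` on `G` near `1`: an `H`-invariant map `κ` with
a smooth section `s` over the open set `A`, whose fibres on `U` lie in single cosets. -/
structure CosetSlice (E : Type*) [NormedAddCommGroup E] [NormedSpace ℝ E]
    {V : Type*} [NormedAddCommGroup V] [NormedSpace ℝ V]
    {G : Type*} [TopologicalSpace G] [ChartedSpace E G] [Group G] (H : Subgroup G)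
    (κ : G → V) where
  smooth : ContMDiff 𝓘(ℝ, E) 𝓘(ℝ, V) ∞ κ
  invariant : ∀ g, ∀ h ∈ H, κ (g * h) = κ g
  A : Set V
  U : Set G
  s : V → G
  isOpen_A : IsOpen A
  isOpen_U : IsOpen U
  one_mem : 1 ∈ U
  smooth_s : ∀ a ∈ A, ContMDiffAt 𝓘(ℝ, V) 𝓘(ℝ, E) ∞ s a
  s_mem : ∀ a ∈ A, s a ∈ U
  κ_s : ∀ a ∈ A, κ (s a) = a
  κ_mem : ∀ u ∈ U, κ u ∈ A
  s_κ : ∀ u ∈ U, (s (κ u))⁻¹ * u ∈ H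

namespace CosetSlice

variable {H : Subgroup G} {κ : G → V} (D : CosetSlice E H κ)

/-- The coordinate function of the coset chart around `gH`. -/
def coord (g : G) : G ⧸ H → V :=
  Quotient.lift (s := QuotientGroup.leftRel H) (fun h => κ (g⁻¹ * h)) fun a b hab => by
    have h1 : a⁻¹ * b ∈ H := QuotientGroup.leftRel_apply.1 hab
    have h2 := D.invariant (g⁻¹ * a) _ h1
    rw [← h2]
    congr 1
    group

theorem coord_mk (g h : G) : D.coord g (h : G ⧸ H) = κ (g⁻¹ * h) := rfl

variable [LieGroup 𝓘(ℝ, E) ∞ G]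

/-- The coset chart around `gH`. -/
def chart (g : G) : OpenPartialHomeomorph (G ⧸ H) V where
  toFun := D.coord g
  invFun a := ((g * D.s a : G) : G ⧸ H)
  source := (fun h : G => (h : G ⧸ H)) '' ((fun u => g * u) '' D.U)
  target := D.A
  map_source' := by
    rintro _ ⟨_, ⟨u, hu, rfl⟩, rfl⟩
    rw [coord_mk, inv_mul_cancel_left]
    exact D.κ_mem u hu
  map_target' a ha := ⟨_, ⟨_, D.s_mem a ha, rfl⟩, rfl⟩
  left_inv' := by
    rintro _ ⟨_, ⟨u, hu, rfl⟩, rfl⟩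
    rw [coord_mk, inv_mul_cancel_left]
    refine QuotientGroup.eq.2 ?_
    have := D.s_κ u hu
    simpa [mul_assoc] using this
  right_inv' a ha := by rw [coord_mk, inv_mul_cancel_left, D.κ_s a ha]
  open_source := by
    have := isTopologicalGroup_of_smooth E G
    exact QuotientGroup.isOpenMap_coe _ (isOpenMap_mul_left g _ D.isOpen_U)
  open_target := D.isOpen_A
  continuousOn_toFun := by
    have := isTopologicalGroup_of_smooth E G
    exact (Continuous.quotient_lift (D.smooth.continuous.comp (continuous_const_mul g⁻¹)) _).continuousOn
  continuousOn_invFun := fun a ha => by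
    have := isTopologicalGroup_of_smooth E G
    have h1 : ContinuousAt D.s a := (D.smooth_s a ha).continuousAt
    have h2 : Continuous fun h : G => ((g * h : G) : G ⧸ H) :=
      continuous_quot_mk.comp (continuous_const_mul g)
    exact (h2.continuousAt.comp h1).continuousWithinAt

/-- The manifold structure on the coset space defined by a slice. -/
abbrev chartedSpace : ChartedSpace V (G ⧸ H) where
  atlas := Set.range D.chart
  chartAt x := D.chart x.out
  mem_chart_source x := ⟨_, ⟨1, D.one_mem, rfl⟩, by simp⟩
  chart_mem_atlas x := ⟨_, rfl⟩

/-- The transition maps are a ↦ κ(g'⁻¹ g s(a)), composites of smooth maps. -/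
theorem isManifold : @IsManifold _ _ _ _ _ _ _ 𝓘(ℝ, V) ∞ (G ⧸ H) _ D.chartedSpace := by
  let _ := D.chartedSpace
  refine isManifold_of_contDiffOn _ _ _ ?_
  rintro _ _ ⟨g, rfl⟩ ⟨g', rfl⟩
  intro a ha
  have haA : a ∈ D.A := ha.1.1
  have h1 : ContMDiffAt 𝓘(ℝ, V) 𝓘(ℝ, V) ∞ (fun a => κ (g'⁻¹ * (g * D.s a))) a :=
    (D.smooth _).comp a ((contMDiff_leftMul _ _).comp a
      ((contMDiff_leftMul _ _).comp a (D.smooth_s a haA)))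
  exact h1.contDiffAt.contDiffWithinAt

theorem contMDiff_mk :
    letI := D.chartedSpace
    ContMDiff 𝓘(ℝ, E) 𝓘(ℝ, V) ∞ (fun g : G => (g : G ⧸ H)) := by
  let _ := D.chartedSpace
  intro k
  rw [contMDiffAt_iff_target]
  refine ⟨continuous_quot_mk.continuousAt, ?_⟩
  exact (D.smooth _).comp k (contMDiff_leftMul _ k)

theorem exists_lift (x : G ⧸ H) :
    letI := D.chartedSpace
    ∃ s : V → G, ∀ y ∈ (extChartAt 𝓘(ℝ, V) x).target,
      ContMDiffAt 𝓘(ℝ, V) 𝓘(ℝ, E) ∞ s y ∧ (extChartAt 𝓘(ℝ, V) x).symm y = ((s y : G) : G ⧸ H) := by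
  let _ := D.chartedSpace
  refine ⟨fun a => x.out * D.s a, fun y hy => ⟨?_, rfl⟩⟩
  have hy' : y ∈ D.A := by
    rw [extChartAt_target] at hy
    exact hy.1
  exact (contMDiff_leftMul _ _).comp y (D.smooth_s y hy')

/-- An inverse chart equals π ∘ s, so Tπ is onto at the lifted point, which lies in kH. Right
translation by an element of H does not change π and carries that point to k. -/
theorem surjective_tderiv_mk (k : G) :
    letI := D.chartedSpace
    Function.Surjective (tderiv E V (fun g : G => (g : G ⧸ H)) k) := by
  let _ := D.chartedSpace
  have := D.isManifold
  have hπ := D.contMDiff_mk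
  set π : G → G ⧸ H := fun g : G => (g : G ⧸ H) with hπdef
  obtain ⟨s, hs⟩ := D.exists_lift (π k)
  set φ := extChartAt 𝓘(ℝ, V) (π k) with hφ
  have hy : φ (π k) ∈ φ.target := mem_extChartAt_target (π k)
  obtain ⟨hs1, hs2⟩ := hs _ hy
  have hx : φ.symm (φ (π k)) = π k := extChartAt_to_inv (π k)
  have hH : k⁻¹ * s (φ (π k)) ∈ H := QuotientGroup.eq.1 (hx.symm.trans hs2)
  have h1 : tderiv V V φ.symm (φ (π k)) =
      (tderiv E V π (s (φ (π k)))).comp (tderiv V E s (φ (π k))) := by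
    rw [← tderiv_comp (hπ.mdiffAt _) hs1.mdiffAt]
    refine tderiv_congr ?_
    filter_upwards [(isOpen_extChartAt_target (I := 𝓘(ℝ, V)) (π k)).mem_nhds hy] with z hz
    exact (hs z hz).2
  have h2 : tderiv E V π (s (φ (π k))) =
      (tderiv E V π k).comp (tderiv E E (fun g => g * (k⁻¹ * s (φ (π k)))⁻¹) (s (φ (π k)))) := by
    have hk : s (φ (π k)) * (k⁻¹ * s (φ (π k)))⁻¹ = k := by group
    have h3 : (fun g => π (g * (k⁻¹ * s (φ (π k)))⁻¹)) = π := by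
      ext1 g
      exact QuotientGroup.eq.2 (by simpa using hH)
    rw [← congrArg (fun f => tderiv E V f (s (φ (π k)))) h3, tderiv_comp (hπ.mdiffAt _) ((contMDiff_rightMul _).mdiffAt _), hk]
  intro v
  rw [h2, tderiv_chart_symm_self] at h1
  exact ⟨_, (DFunLike.congr_fun h1 v).symm⟩

end CosetSlice

/-- A function on a manifold is smooth if its composition with a map through which the inverse
charts lift is smooth. -/
theorem contMDiff_of_comp_lift {M : Type*} [TopologicalSpace M] [ChartedSpace E M]
    {N : Type*} [TopologicalSpace N] [ChartedSpace V N] [IsManifold 𝓘(ℝ, V) ∞ N]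
    {W : Type*} [NormedAddCommGroup W] [NormedSpace ℝ W] {π : M → N}
    (hs : ∀ x : N, ∃ s : V → M, ∀ y ∈ (extChartAt 𝓘(ℝ, V) x).target,
      ContMDiffAt 𝓘(ℝ, V) 𝓘(ℝ, E) ∞ s y ∧ (extChartAt 𝓘(ℝ, V) x).symm y = π (s y))
    {f : N → W} (hf : ContMDiff 𝓘(ℝ, E) 𝓘(ℝ, W) ∞ fun m => f (π m)) :
    ContMDiff 𝓘(ℝ, V) 𝓘(ℝ, W) ∞ f := by
  intro x
  obtain ⟨s, hs⟩ := hs x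
  set φ := extChartAt 𝓘(ℝ, V) x with hφ
  have hx : x ∈ φ.source := mem_extChartAt_source x
  have h1 : ContMDiffAt 𝓘(ℝ, V) 𝓘(ℝ, W) ∞ (fun y => f (π (s (φ y)))) x :=
    (hf _).comp x ((hs _ (φ.map_source hx)).1.comp x (contMDiffAt_chart hx))
  refine h1.congr_of_eventuallyEq ?_
  filter_upwards [(isOpen_extChartAt_source (I := 𝓘(ℝ, V)) x).mem_nhds hx] with y hy
  rw [← (hs _ (φ.map_source hy)).2, φ.left_inv hy]

end CosetSpace

section OrbitMap

variable {E : Type*} [NormedAddCommGroup E] [NormedSpace ℝ E]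
variable {W : Type*} [NormedAddCommGroup W] [NormedSpace ℝ W]
variable {G : Type*} [TopologicalSpace G] [ChartedSpace E G] [Group G] [LieGroup 𝓘(ℝ, E) ∞ G]

theorem tderiv_equivariant {f : G → W} (hf : ContMDiff 𝓘(ℝ, E) 𝓘(ℝ, W) ∞ f)
    {a : G → W → W} (ha : ∀ g, ContDiff ℝ ∞ (a g)) (hfa : ∀ g h, f (g * h) = a g (f h)) (g h : G) :
    tderiv E W f h = ((fderiv ℝ (a g) (f (g⁻¹ * h))).comp (tderiv E W f (g⁻¹ * h))).comp
      (tderiv E E (fun x => g⁻¹ * x) h) := by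
  have h1 : f = fun x => a g (f (g⁻¹ * x)) := by
    ext1 x; rw [← hfa, mul_inv_cancel_left]
  conv_lhs => rw [h1]
  rw [tderiv_comp (g := a g) (f := fun x => f (g⁻¹ * x)) ((ha g).contMDiff.mdiffAt _)
    ((hf.comp (contMDiff_leftMul _)).mdiffAt _), tderiv_eq_fderiv,
    tderiv_comp (hf.mdiffAt _) ((contMDiff_leftMul _).mdiffAt _)]
  rfl

variable [FiniteDimensional ℝ E]

/-- Equivariance expresses the derivative at h through the one at g. As g and h are arbitrary, the
rank is constant. -/
theorem finrank_range_tderiv_le {f : G → W} (hf : ContMDiff 𝓘(ℝ, E) 𝓘(ℝ, W) ∞ f)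
    {a : G → W → W} (ha : ∀ g, ContDiff ℝ ∞ (a g)) (hfa : ∀ g h, f (g * h) = a g (f h)) (g h : G) :
    Module.finrank ℝ (LinearMap.range (tderiv E W f h : E →ₗ[ℝ] W)) ≤
      Module.finrank ℝ (LinearMap.range (tderiv E W f g : E →ₗ[ℝ] W)) := by
  have h1 := tderiv_equivariant hf ha hfa (h * g⁻¹) h
  have h2 : (h * g⁻¹)⁻¹ * h = g := by group
  rw [h2] at h1
  have h3 : LinearMap.range (tderiv E W f h : E →ₗ[ℝ] W) ≤
      (LinearMap.range (tderiv E W f g : E →ₗ[ℝ] W)).map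
        (fderiv ℝ (a (h * g⁻¹)) (f g) : W →ₗ[ℝ] W) := by
    rintro _ ⟨x, rfl⟩
    exact ⟨_, ⟨_, rfl⟩, (DFunLike.congr_fun h1 x).symm⟩
  exact (Submodule.finrank_mono h3).trans (Submodule.finrank_map_le _ _)

variable [FiniteDimensional ℝ W]

/-- The orbit map of a smooth action admits a slice for the isotropy group. -/
theorem exists_cosetSlice {f : G → W} (hf : ContMDiff 𝓘(ℝ, E) 𝓘(ℝ, W) ∞ f)
    {a : G → W → W} (ha : ∀ g, ContDiff ℝ ∞ (a g)) (hfa : ∀ g h, f (g * h) = a g (f h))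
    (H : Subgroup G) (hH : ∀ g h, f g = f h ↔ g⁻¹ * h ∈ H) (V : Submodule ℝ W)
    (hV : LinearMap.range (tderiv E W f 1 : E →ₗ[ℝ] W) = V) :
    ∃ κ : G → V, Nonempty (CosetSlice E H κ) := by
  obtain ⟨p₀, hp₀⟩ := V.subtype.exists_leftInverse_of_injective (by simp)
  let p : W →L[ℝ] V := LinearMap.toContinuousLinearMap p₀
  have hp : ∀ v : V, p v = v := fun v => LinearMap.congr_fun hp₀ v
  set φ := extChartAt 𝓘(ℝ, E) (1 : G) with hφ
  have hS : IsOpen φ.target := isOpen_extChartAt_target _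
  have hff : ∀ y ∈ φ.target, tderiv E W (fun y => f (φ.symm y)) y =
      (tderiv E W f (φ.symm y)).comp (tderiv E E φ.symm y) := fun y hy =>
    tderiv_comp (hf.mdiffAt _) (contMDiffAt_chart_symm hy).mdiffAt
  have h1 : φ (1 : G) ∈ φ.target := mem_extChartAt_target _
  have h1' : φ.symm (φ 1) = 1 := extChartAt_to_inv _
  have hcomp : CompleteSpace E := FiniteDimensional.complete ℝ E
  obtain ⟨A, U, s, hA, hU, h1U, hUS, hs, hsU, hpf, hpA, hsp⟩ :=
    exists_local_factorization (f := fun y => f (φ.symm y)) hS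
      (fun y hy => ((hf _).comp y (contMDiffAt_chart_symm hy)).contDiffAt) h1 V
      (by rw [← tderiv_eq_fderiv, hff _ h1, h1', tderiv_chart_symm_self]; exact hV)
      (fun y hy => by
        rw [← tderiv_eq_fderiv, hff y hy, ← hV]
        refine (Submodule.finrank_mono ?_).trans (finrank_range_tderiv_le hf ha hfa 1 (φ.symm y))
        exact LinearMap.range_comp_le_range (tderiv E E φ.symm y : E →ₗ[ℝ] E)
          (tderiv E W f (φ.symm y) : E →ₗ[ℝ] W)) p hp
  have hl : ∀ g ∈ φ.source, φ.symm (φ g) = g := fun g hg => φ.left_inv hg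
  have hr : ∀ y ∈ φ.target, φ (φ.symm y) = y := fun y hy => φ.right_inv hy
  refine ⟨fun g => p (f g), ⟨?_⟩⟩
  exact
    { smooth := p.contMDiff.comp hf
      invariant := fun g h hh => by
        have : f g = f (g * h) := (hH _ _).2 (by simpa using hh)
        rw [← this]
      A := A
      U := φ.source ∩ φ ⁻¹' U
      s := fun a => φ.symm (s a)
      isOpen_A := hA
      isOpen_U := isOpen_extChartAt_preimage' (I := 𝓘(ℝ, E)) (1 : G) hU
      one_mem := ⟨mem_extChartAt_source _, h1U⟩
      smooth_s := fun a ha =>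
        (contMDiffAt_chart_symm (hUS (hsU a ha))).comp a (hs a ha).contMDiffAt
      s_mem := fun a ha => by
        have h2 := hUS (hsU a ha)
        refine ⟨φ.map_target h2, ?_⟩
        rw [Set.mem_preimage, hr _ h2]
        exact hsU a ha
      κ_s := hpf
      κ_mem := fun g hg => by
        have := hpA _ hg.2
        rwa [hl g hg.1] at this
      -- The factorization gives f(s(κ(g))) = f(g), and by `hH` equal values of f mean equal cosets.
      s_κ := fun g hg => by
        have := hsp _ hg.2
        simp only [hl g hg.1] at this
        exact (hH _ _).1 this }

end OrbitMap

/-! ### Translations, adjoint maps and multiplication in the chart at the identity. -/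

section LieGroupCalculus

theorem contMDiffAt_fderiv_param {P : Type*} [NormedAddCommGroup P] [NormedSpace ℝ P]
    {E : Type*} [NormedAddCommGroup E] [NormedSpace ℝ E]
    {W : Type*} [NormedAddCommGroup W] [NormedSpace ℝ W]
    {N : Type*} [TopologicalSpace N] [ChartedSpace P N] [IsManifold 𝓘(ℝ, P) ∞ N]
    {f : N → E → W} {x : N} {y : E}
    (hf : ContMDiffAt (𝓘(ℝ, P).prod 𝓘(ℝ, E)) 𝓘(ℝ, W) ∞ (Function.uncurry f) (x, y)) :
    ContMDiffAt 𝓘(ℝ, P) 𝓘(ℝ, E →L[ℝ] W) ∞ (fun n => fderiv ℝ (f n) y) x := by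
  set φ := extChartAt 𝓘(ℝ, P) x with hφ
  have hx : x ∈ φ.source := mem_extChartAt_source x
  have hy : φ x ∈ φ.target := mem_extChartAt_target x
  have hinv : φ.symm (φ x) = x := extChartAt_to_inv x
  have h1 : ContMDiffAt 𝓘(ℝ, P × E) 𝓘(ℝ, W) ∞ (fun q : P × E => f (φ.symm q.1) q.2) (φ x, y) := by
    have h2 : ContMDiffAt 𝓘(ℝ, P × E) (𝓘(ℝ, P).prod 𝓘(ℝ, E)) ∞
        (fun q : P × E => (φ.symm q.1, q.2)) (φ x, y) :=
      ((contMDiffAt_chart_symm hy).comp (φ x, y) contDiff_fst.contMDiff.contMDiffAt).prodMk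
        contDiff_snd.contMDiff.contMDiffAt
    exact ContMDiffAt.comp_of_eq hf h2 (by simp [hinv])
  have h3 : ContDiffAt ℝ ∞ (fun z => fderiv ℝ (f (φ.symm z)) y) (φ x) :=
    ContDiffAt.fderiv (f := fun z => f (φ.symm z)) (g := fun _ => y) h1.contDiffAt
      contDiffAt_const (by simp)
  refine (h3.contMDiffAt.comp x (contMDiffAt_chart hx)).congr_of_eventuallyEq ?_
  filter_upwards [(isOpen_extChartAt_source (I := 𝓘(ℝ, P)) x).mem_nhds hx] with n hn
  simp only [Function.comp_apply, φ.left_inv hn]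

variable {E : Type*} [NormedAddCommGroup E] [NormedSpace ℝ E]
variable {G : Type*} [TopologicalSpace G] [ChartedSpace E G] [Group G]

/-- The derivative at `1` of left translation by `g`. -/
def leftMap (g : G) : E →L[ℝ] E := fundMap (E := E) g

/-- The derivative at `1` of right translation by `g`. -/
def rightMap (g : G) : E →L[ℝ] E := tderiv E E (fun h : G => h * g) 1

/-- The Maurer–Cartan form at `g` as a map between model spaces. -/
def mcMap (g : G) : E →L[ℝ] E := maurerCartan (E := E) g

theorem leftMap_eq (g : G) : leftMap (E := E) g = tderiv E E (fun h : G => g * h) 1 := rfl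

theorem rightMap_eq (g : G) : rightMap (E := E) g = tderiv E E (fun h : G => h * g) 1 := rfl

theorem mcMap_eq (g : G) : mcMap (E := E) g = tderiv E E (fun h : G => g⁻¹ * h) g := rfl

theorem Ad_eq (g : G) : Ad (E := E) g = tderiv E E (fun h : G => g * h * g⁻¹) 1 := rfl

theorem mcMap_one : mcMap (E := E) (1 : G) = ContinuousLinearMap.id ℝ E := by
  rw [mcMap_eq, ← tderiv_id (1 : G)]
  congr 1
  ext1 x
  simp

theorem Ad_one : Ad (E := E) (1 : G) = ContinuousLinearMap.id ℝ E := by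
  rw [Ad_eq, ← tderiv_id (1 : G)]
  congr 1
  ext1 x
  simp

/-- The coordinates of the identity in the chart around it. -/
def oneChart (E : Type*) [NormedAddCommGroup E] [NormedSpace ℝ E]
    (G : Type*) [TopologicalSpace G] [ChartedSpace E G] [Group G] : E :=
  extChartAt 𝓘(ℝ, E) (1 : G) 1

theorem oneChart_mem : oneChart E G ∈ (extChartAt 𝓘(ℝ, E) (1 : G)).target :=
  mem_extChartAt_target _

theorem symm_oneChart : (extChartAt 𝓘(ℝ, E) (1 : G)).symm (oneChart E G) = 1 :=
  extChartAt_to_inv _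

variable [LieGroup 𝓘(ℝ, E) ∞ G]

theorem contMDiff_conj (g : G) : ContMDiff 𝓘(ℝ, E) 𝓘(ℝ, E) ∞ fun h : G => g * h * g⁻¹ :=
  (contMDiff_rightMul g⁻¹).comp (contMDiff_leftMul g)

theorem mcMap_comp_left (g h : G) :
    (mcMap (E := E) (g * h)).comp (tderiv E E (fun x : G => g * x) h) =
      mcMap (E := E) h := by
  rw [mcMap_eq, ← tderiv_comp ((contMDiff_leftMul _).mdiffAt _)
    ((contMDiff_leftMul _).mdiffAt _), mcMap_eq]
  congr 1
  ext1 x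
  group

theorem mcMap_leftMap (g : G) (ξ : E) : mcMap g (leftMap g ξ) = ξ := by
  have := mcMap_comp_left (E := E) g 1
  rw [mul_one, mcMap_one] at this
  exact DFunLike.congr_fun this ξ

theorem leftMap_mcMap (g : G) (v : E) :
    leftMap g (mcMap (E := E) g v) = v := by
  have h : (tderiv E E (fun x : G => g * x) 1).comp (tderiv E E (fun x : G => g⁻¹ * x) g) =
      ContinuousLinearMap.id ℝ E := by
    have h0 : g⁻¹ * g = 1 := inv_mul_cancel g
    rw [← h0, ← tderiv_comp ((contMDiff_leftMul _).mdiffAt _)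
      ((contMDiff_leftMul _).mdiffAt _), ← tderiv_id g]
    congr 1
    ext1 x
    group
  exact DFunLike.congr_fun h v

theorem rightMap_Ad (g : G) (ξ : E) : rightMap g (Ad g ξ) = leftMap (E := E) g ξ := by
  have h : (tderiv E E (fun h : G => h * g) 1).comp (tderiv E E (fun h : G => g * h * g⁻¹) 1) =
      tderiv E E (fun h : G => g * h) 1 := by
    have h0 : g * 1 * g⁻¹ = 1 := by group
    have := tderiv_comp (g := fun h : G => h * g) (f := fun h : G => g * h * g⁻¹) (x := 1)
      ((contMDiff_rightMul (E := E) g).mdiffAt _) ((contMDiff_conj g).mdiffAt _)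
    rw [h0] at this
    rw [← this]
    congr 1
    ext1 x
    group
  exact DFunLike.congr_fun h ξ

theorem Ad_mul (g h : G) : Ad (E := E) (g * h) = (Ad (E := E) g).comp (Ad (E := E) h) := by
  have h0 : h * 1 * h⁻¹ = 1 := by group
  have := tderiv_comp (g := fun x : G => g * x * g⁻¹) (f := fun x : G => h * x * h⁻¹) (x := 1)
    ((contMDiff_conj (E := E) g).mdiffAt _) ((contMDiff_conj h).mdiffAt _)
  rw [h0] at this
  rw [Ad_eq g, Ad_eq h, ← this, Ad_eq]
  congr 1
  ext1 x
  group

theorem Ad_Ad_inv (g : G) (ξ : E) : Ad g (Ad (E := E) g⁻¹ ξ) = ξ := by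
  have := Ad_mul (E := E) g g⁻¹
  rw [mul_inv_cancel, Ad_one] at this
  exact (DFunLike.congr_fun this ξ).symm

theorem Ad_inv_Ad (g : G) (ξ : E) : Ad g⁻¹ (Ad (E := E) g ξ) = ξ := by
  have := Ad_mul (E := E) g⁻¹ g
  rw [inv_mul_cancel, Ad_one] at this
  exact (DFunLike.congr_fun this ξ).symm

theorem rightMap_eq_leftMap_Ad_inv (g : G) (ξ : E) :
    rightMap g ξ = leftMap (E := E) g (Ad g⁻¹ ξ) := by
  rw [← rightMap_Ad, Ad_Ad_inv]

theorem tderiv_mul_inv_rightMap (g : G) (ξ : E) :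
    tderiv E E (fun h : G => h * g⁻¹) g (rightMap g ξ) = ξ := by
  have h : (tderiv E E (fun h : G => h * g⁻¹) g).comp (tderiv E E (fun h : G => h * g) 1) =
      ContinuousLinearMap.id ℝ E := by
    have := tderiv_comp (g := fun h : G => h * g⁻¹) (f := fun h : G => h * g) (x := 1)
      ((contMDiff_rightMul (E := E) _).mdiffAt _) ((contMDiff_rightMul _).mdiffAt _)
    rw [one_mul] at this
    rw [← this, ← tderiv_id (1 : G)]
    congr 1
    ext1 x
    group
  exact DFunLike.congr_fun h ξ

theorem rightMap_tderiv_mul_inv (g : G) (v : E) :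
    rightMap g (tderiv E E (fun h : G => h * g⁻¹) g v) = v := by
  have h1 : v = rightMap g (Ad (E := E) g (mcMap (E := E) g v)) := by
    rw [rightMap_Ad, leftMap_mcMap]
  conv_lhs => rw [h1, tderiv_mul_inv_rightMap]
  exact h1.symm

/-- Conjugation fixes 1, so a single chart serves source and target. There Ad_g is an ordinary
derivative of a map depending smoothly on the parameter g. -/
theorem contMDiff_Ad : ContMDiff 𝓘(ℝ, E) 𝓘(ℝ, E →L[ℝ] E) ∞ (Ad (E := E) : G → E →L[ℝ] E) := by
  set φ := extChartAt 𝓘(ℝ, E) (1 : G) with hφ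
  have h1 : φ (1 : G) ∈ φ.target := mem_extChartAt_target _
  have h1' : φ.symm (φ 1) = 1 := extChartAt_to_inv _
  have h1s : (1 : G) ∈ φ.source := mem_extChartAt_source _
  have h0 : ∀ g : G, g * 1 * g⁻¹ = 1 := fun g => by group
  intro g₀
  have hf : ContMDiffAt (𝓘(ℝ, E).prod 𝓘(ℝ, E)) 𝓘(ℝ, E) ∞
      (Function.uncurry fun (g : G) (y : E) => φ (g * φ.symm y * g⁻¹)) (g₀, φ 1) := by
    have h2 : ContMDiffAt (𝓘(ℝ, E).prod 𝓘(ℝ, E)) 𝓘(ℝ, E) ∞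
        (fun q : G × E => φ.symm q.2) (g₀, φ 1) :=
      ContMDiffAt.comp (g₀, φ (1 : G)) (contMDiffAt_chart_symm h1) contMDiffAt_snd
    have h3 : ContMDiffAt (𝓘(ℝ, E).prod 𝓘(ℝ, E)) 𝓘(ℝ, E) ∞
        (fun q : G × E => q.1 * φ.symm q.2 * q.1⁻¹) (g₀, φ 1) :=
      (contMDiffAt_fst.mul h2).mul contMDiffAt_fst.inv
    refine ContMDiffAt.comp_of_eq (contMDiffAt_chart (x := (1 : G)) h1s) h3 ?_
    simp only [h1', h0]
  have h4 := contMDiffAt_fderiv_param hf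
  refine h4.congr_of_eventuallyEq (Filter.Eventually.of_forall fun g => ?_)
  beta_reduce
  rw [← tderiv_eq_fderiv, tderiv_comp (g := fun x => φ x) (f := fun y => g * φ.symm y * g⁻¹)
    (by rw [h1', h0]; exact (contMDiffAt_chart h1s).mdiffAt)
    (((contMDiff_conj g _).comp _ (contMDiffAt_chart_symm h1)).mdiffAt), h1', h0,
    tderiv_chart_self, tderiv_comp (g := fun x => g * x * g⁻¹) ((contMDiff_conj g).mdiffAt _)
      (contMDiffAt_chart_symm h1).mdiffAt, h1', tderiv_chart_symm_self, Ad_eq]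
  rfl

/-- The Maurer–Cartan form in the chart around `x`. -/
def mcChart (x : G) (y : E) : E →L[ℝ] E :=
  (mcMap (E := E) ((extChartAt 𝓘(ℝ, E) x).symm y)).comp
    (tderiv E E (extChartAt 𝓘(ℝ, E) x).symm y)

/-- At z it is the derivative in w, taken on the diagonal w = z, of the jointly smooth φ(ψ⁻¹(z)⁻¹
ψ⁻¹(w)), whose diagonal value is always the centre of φ. -/
theorem contDiffAt_mcChart (x : G) {y : E} (hy : y ∈ (extChartAt 𝓘(ℝ, E) x).target) :
    ContDiffAt ℝ ∞ (mcChart x) y := by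
  set ψ := extChartAt 𝓘(ℝ, E) x with hψ
  set φ := extChartAt 𝓘(ℝ, E) (1 : G) with hφ
  have h1s : (1 : G) ∈ φ.source := mem_extChartAt_source _
  have hf : ContDiffAt ℝ ∞ (Function.uncurry fun (z w : E) => φ ((ψ.symm z)⁻¹ * ψ.symm w)) (y, y) := by
    have h2 : ContMDiffAt 𝓘(ℝ, E × E) 𝓘(ℝ, E) ∞ (fun q : E × E => (ψ.symm q.1)⁻¹ * ψ.symm q.2) (y, y) :=
      (ContMDiffAt.comp (y, y) (contMDiffAt_chart_symm hy) contDiff_fst.contMDiff.contMDiffAt).inv.mul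
        (ContMDiffAt.comp (y, y) (contMDiffAt_chart_symm hy) contDiff_snd.contMDiff.contMDiffAt)
    exact (ContMDiffAt.comp_of_eq (contMDiffAt_chart (x := (1 : G)) h1s) h2 (by simp)).contDiffAt
  have h3 : ContDiffAt ℝ ∞ (fun z => fderiv ℝ (fun w => φ ((ψ.symm z)⁻¹ * ψ.symm w)) z) y :=
    ContDiffAt.fderiv (f := fun z w => φ ((ψ.symm z)⁻¹ * ψ.symm w)) (g := fun z => z) hf
      contDiffAt_id (by simp)
  refine h3.congr_of_eventuallyEq ?_
  filter_upwards [(isOpen_extChartAt_target (I := 𝓘(ℝ, E)) x).mem_nhds hy] with z hz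
  rw [← tderiv_eq_fderiv, tderiv_comp (g := fun x => φ x) (f := fun w => (ψ.symm z)⁻¹ * ψ.symm w)
    (by rw [inv_mul_cancel]; exact (contMDiffAt_chart h1s).mdiffAt)
    (((contMDiff_leftMul _ _).comp _ (contMDiffAt_chart_symm hz)).mdiffAt), inv_mul_cancel,
    tderiv_chart_self, tderiv_comp (g := fun x => (ψ.symm z)⁻¹ * x) ((contMDiff_leftMul _).mdiffAt _)
      (contMDiffAt_chart_symm hz).mdiffAt]
  rfl

/-- Multiplication in the chart around `1`. -/
def mulChart (G : Type*) [TopologicalSpace G] [ChartedSpace E G] [Group G] (q : E × E) : E :=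
  extChartAt 𝓘(ℝ, E) (1 : G)
    ((extChartAt 𝓘(ℝ, E) (1 : G)).symm q.1 * (extChartAt 𝓘(ℝ, E) (1 : G)).symm q.2)

theorem contDiffAt_mulChart : ContDiffAt ℝ ∞ (mulChart (E := E) G) (oneChart E G, oneChart E G) := by
  have h2 : ContMDiffAt 𝓘(ℝ, E × E) 𝓘(ℝ, E) ∞ (fun q : E × E =>
      (extChartAt 𝓘(ℝ, E) (1 : G)).symm q.1 * (extChartAt 𝓘(ℝ, E) (1 : G)).symm q.2)
      (oneChart E G, oneChart E G) :=
    (ContMDiffAt.comp (oneChart E G, oneChart E G) (contMDiffAt_chart_symm oneChart_mem)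
      contDiff_fst.contMDiff.contMDiffAt).mul
    (ContMDiffAt.comp (oneChart E G, oneChart E G) (contMDiffAt_chart_symm oneChart_mem)
      contDiff_snd.contMDiff.contMDiffAt)
  exact (ContMDiffAt.comp_of_eq (contMDiffAt_chart (mem_extChartAt_source (1 : G))) h2
    (by rw [symm_oneChart, mul_one])).contDiffAt

/-- The second derivative of multiplication at the identity, mixed part. -/
def mulHess (G : Type*) [TopologicalSpace G] [ChartedSpace E G] [Group G] (ξ η : E) : E :=
  fderiv ℝ (fderiv ℝ (mulChart (E := E) G)) (oneChart E G, oneChart E G) (ξ, 0) (0, η)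

theorem mulHess_symm (ξ η : E) : fderiv ℝ (fderiv ℝ (mulChart (E := E) G))
    (oneChart E G, oneChart E G) (0, η) (ξ, 0) = mulHess G ξ η :=
  (contDiffAt_mulChart (G := G)).isSymmSndFDerivAt two_le_infty (0, η) (ξ, 0)

/-- Left translation of `η` in the chart around `1`. -/
def leftChart (G : Type*) [TopologicalSpace G] [ChartedSpace E G] [Group G] (y : E) : E →L[ℝ] E :=
  (fderiv ℝ (mulChart (E := E) G) (y, oneChart E G)).comp (ContinuousLinearMap.inr ℝ E E)

/-- Right translation in the chart around `1`. -/
def rightChart (G : Type*) [TopologicalSpace G] [ChartedSpace E G] [Group G] (y : E) : E →L[ℝ] E :=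
  (fderiv ℝ (mulChart (E := E) G) (oneChart E G, y)).comp (ContinuousLinearMap.inl ℝ E E)

theorem hasFDerivAt_fderiv_mulChart : HasFDerivAt (fderiv ℝ (mulChart (E := E) G))
    (fderiv ℝ (fderiv ℝ (mulChart (E := E) G)) (oneChart E G, oneChart E G))
    (oneChart E G, oneChart E G) :=
  ((contDiffAt_mulChart.fderiv_right (m := ∞) (by simp)).differentiableAt (by simp)).hasFDerivAt

theorem hasFDerivAt_leftChart_apply (η : E) :
    HasFDerivAt (fun y => leftChart (E := E) G y η)
      ((ContinuousLinearMap.apply ℝ E ((0, η) : E × E)).comp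
        ((fderiv ℝ (fderiv ℝ (mulChart (E := E) G)) (oneChart E G, oneChart E G)).comp
          (ContinuousLinearMap.inl ℝ E E))) (oneChart E G) := by
  have h1 : HasFDerivAt (fun y => fderiv ℝ (mulChart (E := E) G) (y, oneChart E G))
      ((fderiv ℝ (fderiv ℝ (mulChart (E := E) G)) (oneChart E G, oneChart E G)).comp
          (ContinuousLinearMap.inl ℝ E E)) (oneChart E G) :=
    HasFDerivAt.comp (oneChart E G) hasFDerivAt_fderiv_mulChart (hasFDerivAt_prodMk_left _ _)
  exact (ContinuousLinearMap.apply ℝ E ((0, η) : E × E)).hasFDerivAt.comp (oneChart E G) h1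

theorem hasFDerivAt_rightChart :
    HasFDerivAt (rightChart (E := E) G)
      (((ContinuousLinearMap.compL ℝ E (E × E) E).flip (ContinuousLinearMap.inl ℝ E E)).comp
        ((fderiv ℝ (fderiv ℝ (mulChart (E := E) G)) (oneChart E G, oneChart E G)).comp
          (ContinuousLinearMap.inr ℝ E E))) (oneChart E G) := by
  have h1 : HasFDerivAt (fun y => fderiv ℝ (mulChart (E := E) G) (oneChart E G, y))
      ((fderiv ℝ (fderiv ℝ (mulChart (E := E) G)) (oneChart E G, oneChart E G)).comp
          (ContinuousLinearMap.inr ℝ E E)) (oneChart E G) :=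
    HasFDerivAt.comp (oneChart E G) hasFDerivAt_fderiv_mulChart (hasFDerivAt_prodMk_right _ _)
  exact ((ContinuousLinearMap.compL ℝ E (E × E) E).flip
    (ContinuousLinearMap.inl ℝ E E)).hasFDerivAt.comp (oneChart E G) h1

theorem eventually_chart_one :
    ∀ᶠ y in nhds (oneChart E G), y ∈ (extChartAt 𝓘(ℝ, E) (1 : G)).target ∧
      DifferentiableAt ℝ (mulChart (E := E) G) (y, oneChart E G) ∧
      DifferentiableAt ℝ (mulChart (E := E) G) (oneChart E G, y) := by
  have h1 := (isOpen_extChartAt_target (I := 𝓘(ℝ, E)) (1 : G)).mem_nhds (oneChart_mem (E := E))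
  have h2 : ∀ᶠ q in nhds (oneChart E G, oneChart E G), DifferentiableAt ℝ (mulChart (E := E) G) q := by
    have h : ContDiffAt ℝ 1 (mulChart (E := E) G) (oneChart E G, oneChart E G) :=
      contDiffAt_mulChart.of_le (by simp)
    filter_upwards [h.eventually (by simp)] with q hq using hq.differentiableAt (by simp)
  have h3 : ContinuousAt (fun y : E => (y, oneChart E G)) (oneChart E G) := by fun_prop
  have h4 : ContinuousAt (fun y : E => (oneChart E G, y)) (oneChart E G) := by fun_prop
  filter_upwards [h1, h3.eventually h2, h4.eventually h2] with y ha hb hc using ⟨ha, hb, hc⟩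

/-- Left-invariant fields in coordinates are partial derivatives of multiplication, so their
derivatives at the identity are second derivatives of multiplication. -/
theorem leftChart_eq {y : E} (hy : y ∈ (extChartAt 𝓘(ℝ, E) (1 : G)).target)
    (hd : DifferentiableAt ℝ (mulChart (E := E) G) (y, oneChart E G)) :
    leftChart (E := E) G y = (tderiv E E (extChartAt 𝓘(ℝ, E) (1 : G))
      ((extChartAt 𝓘(ℝ, E) (1 : G)).symm y)).comp
        (leftMap (E := E) ((extChartAt 𝓘(ℝ, E) (1 : G)).symm y)) := by
  set φ := extChartAt 𝓘(ℝ, E) (1 : G) with hφ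
  have h1 : HasFDerivAt (fun z => mulChart (E := E) G (y, z)) (leftChart (E := E) G y)
      (oneChart E G) :=
    HasFDerivAt.comp (oneChart E G) hd.hasFDerivAt (hasFDerivAt_prodMk_right _ _)
  rw [← h1.fderiv, ← tderiv_eq_fderiv]
  change tderiv E E (fun z => φ (φ.symm y * φ.symm z)) (oneChart E G) = _
  have h2 : φ.symm y * φ.symm (oneChart E G) = φ.symm y := by rw [symm_oneChart, mul_one]
  rw [tderiv_comp (g := fun x => φ x) (f := fun z => φ.symm y * φ.symm z)
    (by rw [h2]; exact (contMDiffAt_chart (φ.map_target hy)).mdiffAt)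
    (((contMDiff_leftMul _ _).comp _ (contMDiffAt_chart_symm oneChart_mem)).mdiffAt), h2,
    tderiv_comp (g := fun x => φ.symm y * x) ((contMDiff_leftMul _).mdiffAt _)
      (contMDiffAt_chart_symm oneChart_mem).mdiffAt, symm_oneChart, oneChart,
      tderiv_chart_symm_self]
  rfl

theorem rightChart_apply_eq {y : E} (hy : y ∈ (extChartAt 𝓘(ℝ, E) (1 : G)).target)
    (hd : DifferentiableAt ℝ (mulChart (E := E) G) (oneChart E G, y)) (η : E) :
    rightChart (E := E) G y η = tderiv E E (extChartAt 𝓘(ℝ, E) (1 : G))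
      ((extChartAt 𝓘(ℝ, E) (1 : G)).symm y)
        (rightMap ((extChartAt 𝓘(ℝ, E) (1 : G)).symm y) η) := by
  set φ := extChartAt 𝓘(ℝ, E) (1 : G) with hφ
  have h1 : HasFDerivAt (fun z => mulChart (E := E) G (z, y)) (rightChart (E := E) G y)
      (oneChart E G) :=
    HasFDerivAt.comp (f := fun z => (z, y)) (oneChart E G) hd.hasFDerivAt
      (hasFDerivAt_prodMk_left _ _)
  rw [← h1.fderiv, ← tderiv_eq_fderiv]
  change tderiv E E (fun z => φ (φ.symm z * φ.symm y)) (oneChart E G) η = _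
  have h2 : φ.symm (oneChart E G) * φ.symm y = φ.symm y := by rw [symm_oneChart, one_mul]
  rw [tderiv_comp (g := fun x => φ x) (f := fun z => φ.symm z * φ.symm y)
    (by rw [h2]; exact (contMDiffAt_chart (φ.map_target hy)).mdiffAt)
    (((contMDiff_rightMul _ _).comp _ (contMDiffAt_chart_symm oneChart_mem)).mdiffAt), h2,
    tderiv_comp (g := fun x => x * φ.symm y) ((contMDiff_rightMul _).mdiffAt _)
      (contMDiffAt_chart_symm oneChart_mem).mdiffAt, symm_oneChart, oneChart,
      tderiv_chart_symm_self]
  rfl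

end LieGroupCalculus

/-! ### Bracket, derivative of Ad and of the Maurer–Cartan form at the identity. -/

section StructureEquation

variable {E : Type*} [NormedAddCommGroup E] [NormedSpace ℝ E]
variable {G : Type*} [TopologicalSpace G] [ChartedSpace E G] [Group G]

theorem leftMap_one : leftMap (E := E) (1 : G) = ContinuousLinearMap.id ℝ E := by
  rw [leftMap_eq, ← tderiv_id (1 : G)]
  congr 1
  ext1 x
  simp

theorem rightMap_one : rightMap (E := E) (1 : G) = ContinuousLinearMap.id ℝ E := by
  rw [rightMap_eq, ← tderiv_id (1 : G)]
  congr 1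
  ext1 x
  simp

variable [LieGroup 𝓘(ℝ, E) ∞ G]

theorem leftChart_one : leftChart (E := E) G (oneChart E G) = ContinuousLinearMap.id ℝ E := by
  have h := eventually_chart_one (E := E) (G := G).self_of_nhds
  rw [leftChart_eq h.1 h.2.1, symm_oneChart, tderiv_chart_self, leftMap_one,
    ContinuousLinearMap.id_comp]

theorem rightChart_one (η : E) : rightChart (E := E) G (oneChart E G) η = η := by
  have h := eventually_chart_one (E := E) (G := G).self_of_nhds
  rw [rightChart_apply_eq h.1 h.2.2, symm_oneChart, tderiv_chart_self, rightMap_one]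
  rfl

theorem fderiv_leftChart_apply (ξ η : E) :
    fderiv ℝ (fun y => leftChart (E := E) G y η) (oneChart E G) ξ = mulHess G ξ η := by
  rw [(hasFDerivAt_leftChart_apply η).fderiv]
  rfl

/-- In the chart, [V, W] = DW(V) - DV(W) for the fields `leftChart`, which are the identity at the
centre and have derivative `mulHess` there. -/
theorem lieBr_eq_mulHess (ξ η : E) : lieBr G ξ η = mulHess G ξ η - mulHess G η ξ := by
  -- The manifold bracket is by definition the flat bracket of the fields pulled back by the inverse
  -- chart; only their germs at the centre matter.
  obtain ⟨V, hV, hbr⟩ : ∃ V : E → E → E,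
      (∀ ζ, V ζ =ᶠ[nhds (oneChart E G)] fun y => leftChart (E := E) G y ζ) ∧
      lieBr G ξ η = ContinuousLinearMap.inverse (tderiv E E (extChartAt 𝓘(ℝ, E) (1 : G)) 1)
        (VectorField.lieBracketWithin ℝ (V ξ) (V η)
          ((extChartAt 𝓘(ℝ, E) (1 : G)).symm ⁻¹' Set.univ ∩ Set.range 𝓘(ℝ, E)) (oneChart E G)) := by
    refine ⟨fun ζ => VectorField.mpullbackWithin 𝓘(ℝ, E) 𝓘(ℝ, E)
      (extChartAt 𝓘(ℝ, E) (1 : G)).symm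
        (mulInvariantVectorField (I := 𝓘(ℝ, E)) (G := G) ζ) (Set.range 𝓘(ℝ, E)),
      fun ζ => ?_, rfl⟩
    filter_upwards [eventually_chart_one (E := E) (G := G)] with y hy
    rw [leftChart_eq hy.1 hy.2.1]
    have h1 : (mfderivWithin 𝓘(ℝ, E) 𝓘(ℝ, E) (extChartAt 𝓘(ℝ, E) (1 : G)).symm
        (Set.range 𝓘(ℝ, E)) y : E →L[ℝ] E) = tderiv E E (extChartAt 𝓘(ℝ, E) (1 : G)).symm y := by
      rw [modelWithCornersSelf_coe, Set.range_id, mfderivWithin_univ]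
      rfl
    have h2 : ContinuousLinearMap.inverse (tderiv E E (extChartAt 𝓘(ℝ, E) (1 : G)).symm y) =
        tderiv E E (extChartAt 𝓘(ℝ, E) (1 : G)) ((extChartAt 𝓘(ℝ, E) (1 : G)).symm y) := by
      refine ContinuousLinearMap.inverse_eq ?_ (tderiv_chart_comp_symm hy.1)
      have := tderiv_symm_comp_chart (F := E) ((extChartAt 𝓘(ℝ, E) (1 : G)).map_target hy.1)
      rwa [(extChartAt 𝓘(ℝ, E) (1 : G)).right_inv hy.1] at this
    exact DFunLike.congr_fun ((congrArg ContinuousLinearMap.inverse h1).trans h2)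
      (leftMap (E := E) ((extChartAt 𝓘(ℝ, E) (1 : G)).symm y) ζ)
  have h4 : (extChartAt 𝓘(ℝ, E) (1 : G)).symm ⁻¹' Set.univ ∩ Set.range 𝓘(ℝ, E) = Set.univ := by
    rw [modelWithCornersSelf_coe, Set.range_id, Set.preimage_univ, Set.univ_inter]
  rw [hbr, h4, tderiv_chart_self, ContinuousLinearMap.inverse_id,
    VectorField.lieBracketWithin_univ, (hV ξ).lieBracket_vectorField_eq (hV η),
    VectorField.lieBracket, fderiv_leftChart_apply, fderiv_leftChart_apply, leftChart_one]
  rfl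

/-- Differentiate gη = (Ad_g η)g at the identity in direction ξ: the left side gives `mulHess G ξ
η`, the right side `mulHess G η ξ` plus the derivative of Ad. -/
theorem tderiv_Ad_one (ξ η : E) :
    tderiv E (E →L[ℝ] E) (Ad (E := E) : G → E →L[ℝ] E) 1 ξ η = lieBr G ξ η := by
  set φ := extChartAt 𝓘(ℝ, E) (1 : G) with hφ
  have hA : HasFDerivAt (fun y => Ad (E := E) (φ.symm y))
      (tderiv E (E →L[ℝ] E) (Ad (E := E) : G → E →L[ℝ] E) 1) (oneChart E G) := by
    have h1 : ContMDiffAt 𝓘(ℝ, E) 𝓘(ℝ, E →L[ℝ] E) ∞ (fun y => Ad (E := E) (φ.symm y))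
        (oneChart E G) := (contMDiff_Ad _).comp _ (contMDiffAt_chart_symm oneChart_mem)
    have h2 := (h1.contDiffAt.differentiableAt (by simp)).hasFDerivAt
    rw [← tderiv_eq_fderiv, tderiv_comp (g := Ad (E := E)) (contMDiff_Ad.mdiffAt _)
      (contMDiffAt_chart_symm oneChart_mem).mdiffAt, symm_oneChart, oneChart,
      tderiv_chart_symm_self, ContinuousLinearMap.comp_id] at h2
    exact h2
  have h3 : HasFDerivAt (fun y => rightChart (E := E) G y (Ad (φ.symm y) η)) _ (oneChart E G) :=
    hasFDerivAt_rightChart.clm_apply (hA.clm_apply (hasFDerivAt_const η _))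
  have h4 : (fun y => leftChart (E := E) G y η) =ᶠ[nhds (oneChart E G)]
      fun y => rightChart (E := E) G y (Ad (φ.symm y) η) := by
    filter_upwards [eventually_chart_one (E := E) (G := G)] with y hy
    rw [leftChart_eq hy.1 hy.2.1, rightChart_apply_eq hy.1 hy.2.2, rightMap_Ad]
    rfl
  have h5 := DFunLike.congr_fun (h4.fderiv_eq.trans h3.fderiv) ξ
  rw [fderiv_leftChart_apply] at h5
  simp only [symm_oneChart, hφ, Ad_one, add_apply,
    ContinuousLinearMap.comp_apply, ContinuousLinearMap.flip_apply, rightChart_one,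
    ContinuousLinearMap.compL_apply, zero_apply, map_zero, zero_add,
    ContinuousLinearMap.inl_apply, ContinuousLinearMap.inr_apply, ContinuousLinearMap.id_apply,
    mulHess_symm] at h5
  rw [lieBr_eq_mulHess, h5]
  abel

theorem mcChart_comp_leftChart {y : E} (hy : y ∈ (extChartAt 𝓘(ℝ, E) (1 : G)).target)
    (hd : DifferentiableAt ℝ (mulChart (E := E) G) (y, oneChart E G)) (ξ : E) :
    mcChart (1 : G) y (leftChart (E := E) G y ξ) = ξ := by
  rw [leftChart_eq hy hd]
  have h1 := tderiv_symm_comp_chart (F := E) ((extChartAt 𝓘(ℝ, E) (1 : G)).map_target hy)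
  rw [(extChartAt 𝓘(ℝ, E) (1 : G)).right_inv hy] at h1
  have h2 := DFunLike.congr_fun h1 (leftMap ((extChartAt 𝓘(ℝ, E) (1 : G)).symm y) ξ)
  have h3 := congrArg (mcMap ((extChartAt 𝓘(ℝ, E) (1 : G)).symm y)) h2
  exact h3.trans (mcMap_leftMap _ _)

theorem mcChart_one : mcChart (1 : G) (oneChart E G) = ContinuousLinearMap.id ℝ E := by
  rw [mcChart, symm_oneChart, oneChart, tderiv_chart_symm_self, mcMap_one,
    ContinuousLinearMap.id_comp]

/-- Differentiate the identity 𝓐(gη) = η, both of whose factors are the identity map at the centre.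
-/
theorem fderiv_mcChart_one (ξ η : E) :
    fderiv ℝ (mcChart (1 : G)) (oneChart E G) ξ η = - mulHess G ξ η := by
  have h1 : HasFDerivAt (mcChart (1 : G)) _ (oneChart E G) :=
    ((contDiffAt_mcChart (1 : G) oneChart_mem).differentiableAt (by simp)).hasFDerivAt
  have h2 := h1.clm_apply (hasFDerivAt_leftChart_apply (G := G) η)
  have h3 : HasFDerivAt (fun y => mcChart (1 : G) y (leftChart (E := E) G y η)) (0 : E →L[ℝ] E)
      (oneChart E G) := by
    refine (hasFDerivAt_const η _).congr_of_eventuallyEq ?_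
    filter_upwards [eventually_chart_one (E := E) (G := G)] with y hy
    exact mcChart_comp_leftChart hy.1 hy.2.1 η
  have h4 := DFunLike.congr_fun (h2.unique h3) ξ
  rw [mcChart_one, leftChart_one] at h4
  exact eq_neg_of_add_eq_zero_right h4

end StructureEquation

/-! ### The exterior derivative of ⟨f, 𝓐⟩. -/

section MaurerCartanForms

variable {E : Type*} [NormedAddCommGroup E] [NormedSpace ℝ E]
variable {G : Type*} [TopologicalSpace G] [ChartedSpace E G] [Group G] [LieGroup 𝓘(ℝ, E) ∞ G]

theorem pairMC_along_left (f : G → E →L[ℝ] ℝ) (g : G) {y : E}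
    (hy : y ∈ (extChartAt 𝓘(ℝ, E) (1 : G)).target) (v : Fin 1 → E) :
    (pairMC f).along (fun y => g * (extChartAt 𝓘(ℝ, E) (1 : G)).symm y) y v =
      f (g * (extChartAt 𝓘(ℝ, E) (1 : G)).symm y) (mcChart (1 : G) y (v 0)) := by
  have h1 := tderiv_comp (g := fun x => g * x) (f := (extChartAt 𝓘(ℝ, E) (1 : G)).symm) (x := y)
    ((contMDiff_leftMul (E := E) g).mdiffAt _) (contMDiffAt_chart_symm hy).mdiffAt
  have h2 := mcMap_comp_left (E := E) g ((extChartAt 𝓘(ℝ, E) (1 : G)).symm y)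
  rw [mcChart, ← h2, ContinuousLinearMap.comp_assoc, ← h1]
  rfl

variable [FiniteDimensional ℝ E]

theorem isSmooth_pairMC {f : G → E →L[ℝ] ℝ} (hf : ContMDiff 𝓘(ℝ, E) 𝓘(ℝ, E →L[ℝ] ℝ) ∞ f) :
    (pairMC f).IsSmooth := by
  intro x y hy
  refine (contDiffAt_alternating_of_apply fun v => ?_).contDiffWithinAt
  have h1 : ContDiffAt ℝ ∞ (fun y => f ((extChartAt 𝓘(ℝ, E) x).symm y)) y :=
    ((hf _).comp y (contMDiffAt_chart_symm hy)).contDiffAt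
  exact h1.clm_apply ((contDiffAt_mcChart x hy).clm_apply contDiffAt_const)

/-- The Cartan formula for `d⟨f, 𝓐⟩` on left-invariant vector fields. -/
theorem d_pairMC_leftMap {f : G → E →L[ℝ] ℝ} (hf : ContMDiff 𝓘(ℝ, E) 𝓘(ℝ, E →L[ℝ] ℝ) ∞ f)
    (g : G) (ξ η : E) :
    (pairMC f).d.at g ![leftMap g ξ, leftMap g η] =
      tderiv E (E →L[ℝ] ℝ) f g (leftMap g ξ) η - tderiv E (E →L[ℝ] ℝ) f g (leftMap g η) ξ -
        f g (lieBr G ξ η) := by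
  set φ := extChartAt 𝓘(ℝ, E) (1 : G) with hφ
  -- By left invariance 𝓐 has the same expression in this translated parametrization for every g, so
  -- its derivative is needed at the identity only.
  set h : E → G := fun y => g * φ.symm y with hh
  have hsm : ContMDiffAt 𝓘(ℝ, E) 𝓘(ℝ, E) ∞ h (oneChart E G) :=
    (contMDiff_leftMul _ _).comp _ (contMDiffAt_chart_symm oneChart_mem)
  have h1 : h (oneChart E G) = g := by simp only [hh, hφ, symm_oneChart, mul_one]
  have h2 : tderiv E E h (oneChart E G) = leftMap g := by
    rw [hh, tderiv_comp (g := fun x => g * x) ((contMDiff_leftMul _).mdiffAt _)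
      (contMDiffAt_chart_symm oneChart_mem).mdiffAt, symm_oneChart, oneChart,
      tderiv_chart_symm_self]
    rfl
  have h3 : (pairMC f).d.at g ![leftMap g ξ, leftMap g η] =
      (pairMC f).d.along h (oneChart E G) ![ξ, η] := by
    rw [DiffForm.along, h1, h2, ContinuousAlternatingMap.compContinuousLinearMap_apply]
    congr 1
    ext1 i
    fin_cases i <;> rfl
  have h4 : ∀ ζ ζ' : E, fderiv ℝ (fun y => (pairMC f).along h y ![ζ']) (oneChart E G) ζ =
      tderiv E (E →L[ℝ] ℝ) f g (leftMap g ζ) ζ' - f g (mulHess G ζ ζ') := by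
    intro ζ ζ'
    have e1 : (fun y => (pairMC f).along h y ![ζ']) =ᶠ[nhds (oneChart E G)]
        fun y => f (h y) (mcChart (1 : G) y ζ') := by
      filter_upwards [eventually_chart_one (E := E) (G := G)] with y hy
      exact pairMC_along_left f g hy.1 _
    have e2 : HasFDerivAt (fun y => f (h y))
        ((tderiv E (E →L[ℝ] ℝ) f g).comp (leftMap g)) (oneChart E G) := by
      have := (((hf _).comp _ hsm).contDiffAt.differentiableAt (by simp)).hasFDerivAt
      rw [← tderiv_eq_fderiv] at this
      change HasFDerivAt (fun y => f (h y)) (tderiv E (E →L[ℝ] ℝ) (fun y => f (h y)) _) _ at this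
      rwa [tderiv_comp (hf.mdiffAt _) hsm.mdiffAt, h1, h2] at this
    have e3 : HasFDerivAt (mcChart (1 : G)) _ (oneChart E G) :=
      ((contDiffAt_mcChart (1 : G) oneChart_mem).differentiableAt (by simp)).hasFDerivAt
    have e4 := e2.clm_apply (e3.clm_apply (hasFDerivAt_const ζ' _))
    rw [e1.fderiv_eq, e4.fderiv]
    simp only [add_apply, ContinuousLinearMap.comp_apply,
      ContinuousLinearMap.flip_apply, zero_apply, map_zero, zero_add, h1,
      fderiv_mcChart_one, mcChart_one, ContinuousLinearMap.id_apply, map_neg]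
    ring
  rw [h3, ← (isSmooth_pairMC hf).extDeriv_along hsm, extDeriv_apply
    (((isSmooth_pairMC hf).along_contDiffAt hsm).differentiableAt (by simp)), Fin.sum_univ_two]
  have r0 : (0 : Fin 2).removeNth ![ξ, η] = ![η] := by ext1 i; fin_cases i; rfl
  have r1 : (1 : Fin 2).removeNth ![ξ, η] = ![ξ] := by ext1 i; fin_cases i; rfl
  rw [r0, r1]
  simp only [Fin.val_zero, Fin.val_one, pow_zero, pow_one, one_smul, neg_smul,
    Matrix.cons_val_zero, Matrix.cons_val_one, h4, lieBr_eq_mulHess, map_sub]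
  ring

end MaurerCartanForms

/-! ### Vector-valued functions on manifolds. -/

section VectorValued

variable {E : Type*} [NormedAddCommGroup E] [NormedSpace ℝ E]
variable {W : Type*} [NormedAddCommGroup W] [NormedSpace ℝ W]
variable {W' : Type*} [NormedAddCommGroup W'] [NormedSpace ℝ W']
variable {M : Type*} [TopologicalSpace M] [ChartedSpace E M]

theorem tderiv_sub {f g : M → W} {x : M} (hf : MDifferentiableAt 𝓘(ℝ, E) 𝓘(ℝ, W) f x)
    (hg : MDifferentiableAt 𝓘(ℝ, E) 𝓘(ℝ, W) g x) :
    tderiv E W (fun y => f y - g y) x = tderiv E W f x - tderiv E W g x :=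
  (hf.hasMFDerivAt.sub hg.hasMFDerivAt).mfderiv

theorem tderiv_const_add (w : W) {f : M → W} {x : M}
    (hf : MDifferentiableAt 𝓘(ℝ, E) 𝓘(ℝ, W) f x) :
    tderiv E W (fun y => w + f y) x = tderiv E W f x := by
  have h1 : HasMFDerivAt 𝓘(ℝ, E) 𝓘(ℝ, W) (fun _ : M => w) x 0 := hasMFDerivAt_const w x
  have h2 : tderiv E W (fun y => w + f y) x = (0 : E →L[ℝ] W) + tderiv E W f x :=
    (h1.add hf.hasMFDerivAt).mfderiv
  rw [h2, zero_add]

theorem tderiv_clm_comp (L : W →L[ℝ] W') {f : M → W} {x : M}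
    (hf : MDifferentiableAt 𝓘(ℝ, E) 𝓘(ℝ, W) f x) :
    tderiv E W' (fun y => L (f y)) x = L.comp (tderiv E W f x) := by
  rw [tderiv_comp (g := L) (f := f) (L.contMDiff.mdiffAt _) hf, tderiv_eq_fderiv, L.fderiv]

theorem eq_of_tderiv_eq_zero [IsManifold 𝓘(ℝ, E) ∞ M] [PreconnectedSpace M] {f : M → W}
    (hf : ContMDiff 𝓘(ℝ, E) 𝓘(ℝ, W) ∞ f) (h : ∀ x, tderiv E W f x = 0) (x y : M) : f x = f y := by
  refine IsLocallyConstant.apply_eq_of_preconnectedSpace ?_ x y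
  rw [IsLocallyConstant.iff_eventually_eq]
  intro x
  set φ := extChartAt 𝓘(ℝ, E) x with hφ
  have hx : x ∈ φ.source := mem_extChartAt_source x
  have hy : φ x ∈ φ.target := mem_extChartAt_target x
  obtain ⟨ε, hε, hball⟩ := Metric.isOpen_iff.1 (isOpen_extChartAt_target (I := 𝓘(ℝ, E)) x) _ hy
  have h1 : ∀ z ∈ Metric.ball (φ x) ε, ContMDiffAt 𝓘(ℝ, E) 𝓘(ℝ, W) ∞ (fun z => f (φ.symm z)) z :=
    fun z hz => (hf _).comp z (contMDiffAt_chart_symm (hball hz))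
  have h2 : ∀ z ∈ Metric.ball (φ x) ε, f (φ.symm z) = f (φ.symm (φ x)) := by
    intro z hz
    refine (convex_ball (φ x) ε).is_const_of_fderivWithin_eq_zero (𝕜 := ℝ)
      (f := fun z => f (φ.symm z))
      (fun z hz => ((h1 z hz).contDiffAt.differentiableAt (by simp)).differentiableWithinAt)
      (fun z hz => ?_) hz (Metric.mem_ball_self hε)
    rw [fderivWithin_of_isOpen Metric.isOpen_ball hz, ← tderiv_eq_fderiv,
      tderiv_comp (hf.mdiffAt _) (contMDiffAt_chart_symm (hball hz)).mdiffAt, h,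
      ContinuousLinearMap.zero_comp]
  have h3 : ∀ᶠ y in nhds x, φ y ∈ Metric.ball (φ x) ε :=
    (continuousAt_extChartAt x).eventually (Metric.ball_mem_nhds _ hε)
  filter_upwards [h3, (isOpen_extChartAt_source (I := 𝓘(ℝ, E)) x).mem_nhds hx] with y hy1 hy2
  have := h2 _ hy1
  rwa [φ.left_inv hy2, φ.left_inv hx] at this

end VectorValued

/-! ### Inversion and the adjoint action. -/

section AdjointAction

variable {E : Type*} [NormedAddCommGroup E] [NormedSpace ℝ E]
variable {G : Type*} [TopologicalSpace G] [ChartedSpace E G] [Group G] [LieGroup 𝓘(ℝ, E) ∞ G]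

theorem contMDiff_groupInv : ContMDiff 𝓘(ℝ, E) 𝓘(ℝ, E) ∞ fun g : G => g⁻¹ :=
  contMDiff_inv 𝓘(ℝ, E) ∞

/-- Differentiate g g⁻¹ = 1 in the chart; the derivative of multiplication at (1, 1) is addition. -/
theorem tderiv_inv_one (ξ : E) : tderiv E E (fun g : G => g⁻¹) 1 ξ = -ξ := by
  set φ := extChartAt 𝓘(ℝ, E) (1 : G) with hφ
  have h1s : (1 : G) ∈ φ.source := mem_extChartAt_source _
  have hsm : ContMDiffAt 𝓘(ℝ, E) 𝓘(ℝ, E) ∞ (fun y => (φ.symm y)⁻¹) (oneChart E G) :=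
    (contMDiff_groupInv _).comp _ (contMDiffAt_chart_symm oneChart_mem)
  have hinv : (φ.symm (oneChart E G))⁻¹ = 1 := by rw [symm_oneChart, inv_one]
  have hsm' : ContMDiffAt 𝓘(ℝ, E) 𝓘(ℝ, E) ∞ (fun y => φ (φ.symm y)⁻¹) (oneChart E G) :=
    ContMDiffAt.comp_of_eq (contMDiffAt_chart h1s) hsm hinv
  have h1 : HasFDerivAt (fun y => φ (φ.symm y)⁻¹) (tderiv E E (fun g : G => g⁻¹) 1)
      (oneChart E G) := by
    have h := (hsm'.contDiffAt.differentiableAt (by simp)).hasFDerivAt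
    rw [← tderiv_eq_fderiv, tderiv_comp (g := fun x => φ x) (f := fun y => (φ.symm y)⁻¹)
      (by rw [hinv]; exact (contMDiffAt_chart h1s).mdiffAt) hsm.mdiffAt, hinv, tderiv_chart_self,
      tderiv_comp (g := fun g : G => g⁻¹) (contMDiff_groupInv.mdiffAt _)
        (contMDiffAt_chart_symm oneChart_mem).mdiffAt, symm_oneChart, oneChart,
      tderiv_chart_symm_self, ContinuousLinearMap.comp_id, ContinuousLinearMap.id_comp] at h
    exact h
  have h2 : φ (φ.symm (oneChart E G))⁻¹ = oneChart E G := by rw [hinv]; rfl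
  have hm : HasFDerivAt (mulChart (E := E) G) (fderiv ℝ (mulChart (E := E) G)
      (oneChart E G, oneChart E G)) (oneChart E G, φ (φ.symm (oneChart E G))⁻¹) := by
    rw [h2]
    exact (contDiffAt_mulChart.differentiableAt (by simp)).hasFDerivAt
  have h3 : HasFDerivAt (fun y => mulChart (E := E) G (y, φ (φ.symm y)⁻¹)) _ (oneChart E G) :=
    HasFDerivAt.comp (f := fun y => (y, φ (φ.symm y)⁻¹)) (oneChart E G) hm
      ((hasFDerivAt_id (oneChart E G)).prodMk h1)
  have h4 : HasFDerivAt (fun y => mulChart (E := E) G (y, φ (φ.symm y)⁻¹)) (0 : E →L[ℝ] E)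
      (oneChart E G) := by
    refine (hasFDerivAt_const (φ 1) _).congr_of_eventuallyEq ?_
    have hs : ∀ᶠ y in nhds (oneChart E G), (φ.symm y)⁻¹ ∈ φ.source := by
      refine hsm.continuousAt.eventually ?_
      beta_reduce
      rw [hinv]
      exact (isOpen_extChartAt_source (I := 𝓘(ℝ, E)) (1 : G)).mem_nhds h1s
    filter_upwards [hs] with y hy
    change φ (φ.symm y * φ.symm (φ (φ.symm y)⁻¹)) = φ 1
    rw [φ.left_inv hy, mul_inv_cancel]
  have h5 := DFunLike.congr_fun (h3.unique h4) ξ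
  have h6 : ∀ η : E, fderiv ℝ (mulChart (E := E) G) (oneChart E G, oneChart E G) (ξ, η) = ξ + η := by
    intro η
    have a1 : fderiv ℝ (mulChart (E := E) G) (oneChart E G, oneChart E G) (ξ, 0) = ξ :=
      rightChart_one ξ
    have a2 : fderiv ℝ (mulChart (E := E) G) (oneChart E G, oneChart E G) (0, η) = η :=
      DFunLike.congr_fun leftChart_one η
    have a3 : ((ξ, η) : E × E) = (ξ, 0) + (0, η) := by simp
    rw [a3, map_add, a1, a2]
  exact eq_neg_of_add_eq_zero_right ((h6 _).symm.trans h5)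

theorem contMDiff_Ad_inv :
    ContMDiff 𝓘(ℝ, E) 𝓘(ℝ, E →L[ℝ] E) ∞ fun g : G => Ad (E := E) g⁻¹ :=
  contMDiff_Ad.comp contMDiff_groupInv

theorem tderiv_Ad_inv_one (ξ η : E) :
    tderiv E (E →L[ℝ] E) (fun g : G => Ad (E := E) g⁻¹) 1 ξ η = -lieBr G ξ η := by
  rw [tderiv_comp (g := Ad (E := E)) (f := fun g : G => g⁻¹) (contMDiff_Ad.mdiffAt _)
    (contMDiff_groupInv.mdiffAt _), inv_one, ContinuousLinearMap.comp_apply, tderiv_inv_one,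
    map_neg, neg_apply, tderiv_Ad_one]

theorem lieBr_skew (ξ η : E) : lieBr G ξ η = -lieBr G η ξ := by
  rw [lieBr_eq_mulHess, lieBr_eq_mulHess, neg_sub]

/-- Differentiate Ad_{ghg⁻¹} = Ad_g Ad_h Ad_{g⁻¹} at h = 1 and apply the result to Ad_g η. -/
theorem lieBr_Ad (g : G) (ξ η : E) : lieBr G (Ad g ξ) (Ad g η) = Ad g (lieBr G ξ η) := by
  let L : (E →L[ℝ] E) →L[ℝ] (E →L[ℝ] E) :=
    (ContinuousLinearMap.compL ℝ E E E (Ad g)).comp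
      ((ContinuousLinearMap.compL ℝ E E E).flip (Ad g⁻¹))
  have h1 : (fun h : G => Ad (E := E) (g * h * g⁻¹)) = fun h : G => L (Ad h) := by
    ext1 h
    rw [Ad_mul, Ad_mul]
    rfl
  have h2 : tderiv E (E →L[ℝ] E) (fun h : G => Ad (E := E) (g * h * g⁻¹)) 1 =
      (tderiv E (E →L[ℝ] E) (Ad (E := E) : G → E →L[ℝ] E) 1).comp (Ad g) := by
    have h0 : g * 1 * g⁻¹ = 1 := by group
    have := tderiv_comp (g := Ad (E := E)) (f := fun h : G => g * h * g⁻¹) (x := 1)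
      (contMDiff_Ad.mdiffAt _) ((contMDiff_conj (E := E) g).mdiffAt _)
    rwa [h0] at this
  have h3 := tderiv_clm_comp L ((contMDiff_Ad (E := E) (G := G)).mdiffAt 1)
  have h4 := DFunLike.congr_fun (DFunLike.congr_fun
    (h2.symm.trans ((congrArg (fun f => tderiv E (E →L[ℝ] E) f 1) h1).trans h3)) ξ) (Ad g η)
  rw [ContinuousLinearMap.comp_apply, tderiv_Ad_one] at h4
  rw [h4]
  change Ad g (tderiv E (E →L[ℝ] E) (Ad (E := E) : G → E →L[ℝ] E) 1 ξ (Ad g⁻¹ (Ad g η))) = _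
  rw [Ad_inv_Ad, tderiv_Ad_one]

end AdjointAction

/-! ### Potentials of invariant forms and their cocycles. -/

section Potentials

variable {E : Type*} [NormedAddCommGroup E] [NormedSpace ℝ E]
variable {G : Type*} [TopologicalSpace G] [ChartedSpace E G] [Group G]
variable {B : DiffForm E G 2} {δ : G → E →L[ℝ] ℝ}

theorem two_form_swap (α : E [⋀^Fin 2]→L[ℝ] ℝ) (v w : E) : α ![v, w] = -α ![w, v] := by
  have h := α.toAlternatingMap.map_swap ![w, v] (i := 0) (j := 1) (by decide)
  have h2 : ![w, v] ∘ Equiv.swap (0 : Fin 2) 1 = ![v, w] := by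
    ext1 i; fin_cases i <;> rfl
  rw [h2] at h
  exact h

theorem IsInvariantMagnetic.apply_leftMap (hB : IsInvariantMagnetic B δ) (g : G) (ξ v : E) :
    B.at g ![leftMap g ξ, v] = tderiv E (E →L[ℝ] ℝ) δ g v ξ := by
  have h1 : B.at g ![leftMap g ξ, v] = tderiv E ℝ (fun h : G => δ h ξ) g v := hB.potential ξ g v
  have h2 := tderiv_clm_comp (ContinuousLinearMap.apply ℝ ℝ ξ) (hB.smooth_potential.mdiffAt g)
  rw [h1]
  exact DFunLike.congr_fun h2 v

theorem IsInvariantMagnetic.apply_rightMul (hB : IsInvariantMagnetic B δ) (g h : G) (v w : E) :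
    B.at (h * g) ![tderiv E E (fun x : G => x * g) h v, tderiv E E (fun x : G => x * g) h w] =
      B.at h ![v, w] := by
  have h1 : (B.pullback (F := E) (fun x : G => x * g)).at h ![v, w] = B.at h ![v, w] := by
    rw [hB.invariant g]
  rw [← h1, DiffForm.pullback_at, ContinuousAlternatingMap.compContinuousLinearMap_apply]
  congr 1
  ext1 i
  fin_cases i <;> rfl

/-- Right invariance moves the evaluation to the identity, where left and right translates coincide
and the potential equation applies. -/
theorem IsInvariantMagnetic.apply_rightMap (hB : IsInvariantMagnetic B δ) (g : G) (ξ η : E) :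
    B.at g ![rightMap g ξ, rightMap g η] = tderiv E (E →L[ℝ] ℝ) δ 1 η ξ := by
  have h1 := hB.apply_rightMul g 1 ξ η
  have h2 := hB.apply_leftMap 1 ξ η
  rw [leftMap_one, ContinuousLinearMap.id_apply] at h2
  rw [one_mul, h2] at h1
  exact h1

variable [LieGroup 𝓘(ℝ, E) ∞ G]

/-- The right side is constant in p. By the potential equation its derivative is a difference of two
values of B, on vectors that correspond under right translation by g⁻¹. -/
theorem cocycle_eq [PreconnectedSpace G] (hB : IsInvariantMagnetic B δ) (p g : G) :
    cocycle δ g = δ (p * g⁻¹) - coAd g⁻¹ (δ p) := by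
  have hδ := hB.smooth_potential
  let L : (E →L[ℝ] ℝ) →L[ℝ] (E →L[ℝ] ℝ) := (ContinuousLinearMap.compL ℝ E E ℝ).flip (Ad g⁻¹)
  have hs1 : ContMDiff 𝓘(ℝ, E) 𝓘(ℝ, E →L[ℝ] ℝ) ∞ fun p : G => δ (p * g⁻¹) :=
    hδ.comp (contMDiff_rightMul g⁻¹)
  have hs2 : ContMDiff 𝓘(ℝ, E) 𝓘(ℝ, E →L[ℝ] ℝ) ∞ fun p : G => L (δ p) :=
    L.contMDiff.comp hδ
  have key : ∀ p : G, tderiv E (E →L[ℝ] ℝ) (fun p : G => δ (p * g⁻¹) - L (δ p)) p = 0 := by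
    intro p
    ext v ξ
    rw [tderiv_sub (hs1.mdiffAt p) (hs2.mdiffAt p), tderiv_clm_comp L (hδ.mdiffAt p),
      tderiv_comp (g := δ) (f := fun p : G => p * g⁻¹) (hδ.mdiffAt _)
        ((contMDiff_rightMul _).mdiffAt _)]
    change tderiv E (E →L[ℝ] ℝ) δ (p * g⁻¹) (tderiv E E (fun p : G => p * g⁻¹) p v) ξ -
      tderiv E (E →L[ℝ] ℝ) δ p v (Ad g⁻¹ ξ) = 0
    -- This is (p g⁻¹)ξ = (p Ad_{g⁻¹}ξ) g⁻¹: it explains the Ad^* in the cocycle.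
    have h1 : leftMap (E := E) (p * g⁻¹) ξ =
        tderiv E E (fun p : G => p * g⁻¹) p (leftMap p (Ad g⁻¹ ξ)) := by
      have h0 : g⁻¹ * 1 * g⁻¹⁻¹ = 1 := by group
      have e1 := tderiv_comp (g := fun x : G => p * x) (f := fun x : G => g⁻¹ * x * g⁻¹⁻¹) (x := 1)
        ((contMDiff_leftMul (E := E) p).mdiffAt _) ((contMDiff_conj g⁻¹).mdiffAt _)
      have e2 := tderiv_comp (g := fun x : G => x * g⁻¹)
        (f := fun x : G => p * (g⁻¹ * x * g⁻¹⁻¹)) (x := 1)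
        ((contMDiff_rightMul (E := E) g⁻¹).mdiffAt _)
        (((contMDiff_leftMul p).comp (contMDiff_conj g⁻¹)).mdiffAt _)
      rw [e1, h0, mul_one] at e2
      have e3 : (fun x : G => p * (g⁻¹ * x * g⁻¹⁻¹) * g⁻¹) = fun x : G => p * g⁻¹ * x := by
        ext1 x; group
      rw [e3] at e2
      exact DFunLike.congr_fun e2 ξ
    rw [← hB.apply_leftMap, ← hB.apply_leftMap, h1, hB.apply_rightMul, sub_self]
  have h2 := eq_of_tderiv_eq_zero (hs1.sub hs2) key 1 p
  simp only [one_mul] at h2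
  exact h2

theorem contMDiff_cocycle (hδ : ContMDiff 𝓘(ℝ, E) 𝓘(ℝ, E →L[ℝ] ℝ) ∞ δ) :
    ContMDiff 𝓘(ℝ, E) 𝓘(ℝ, E →L[ℝ] ℝ) ∞ (cocycle δ) := by
  have h1 : ContMDiff 𝓘(ℝ, E) 𝓘(ℝ, E →L[ℝ] ℝ) ∞
      fun g : G => ContinuousLinearMap.compL ℝ E E ℝ (δ 1) (Ad (E := E) g⁻¹) :=
    (ContinuousLinearMap.compL ℝ E E ℝ (δ 1)).contMDiff.comp contMDiff_Ad_inv
  exact (hδ.comp contMDiff_groupInv).sub h1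

theorem infCocycle_apply (hδ : ContMDiff 𝓘(ℝ, E) 𝓘(ℝ, E →L[ℝ] ℝ) ∞ δ) (ξ η : E) :
    infCocycle δ ξ η = tderiv E (E →L[ℝ] ℝ) δ 1 ξ η - δ 1 (lieBr G ξ η) := by
  let L := ContinuousLinearMap.compL ℝ E E ℝ (δ 1)
  have h1 := tderiv_clm_comp L ((contMDiff_Ad_inv (E := E) (G := G)).mdiffAt 1)
  have h2 := tderiv_comp (g := δ) (f := fun g : G => g⁻¹) (x := 1) (hδ.mdiffAt _)
    ((contMDiff_groupInv (E := E)).mdiffAt _)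
  have h3 := tderiv_sub (f := fun g : G => δ g⁻¹) (g := fun g : G => L (Ad g⁻¹)) (x := 1)
    ((hδ.comp contMDiff_groupInv).mdiffAt _) ((L.contMDiff.comp contMDiff_Ad_inv).mdiffAt _)
  have h4 : infCocycle δ ξ η =
      -(tderiv E (E →L[ℝ] ℝ) (fun g : G => δ g⁻¹ - L (Ad g⁻¹)) 1 ξ η) := rfl
  rw [h4, h3, h1, h2, inv_one]
  change -(tderiv E (E →L[ℝ] ℝ) δ 1 (tderiv E E (fun g : G => g⁻¹) 1 ξ) η -
    δ 1 (tderiv E (E →L[ℝ] E) (fun g : G => Ad (E := E) g⁻¹) 1 ξ η)) = _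
  rw [tderiv_inv_one, tderiv_Ad_inv_one, map_neg, neg_apply, map_neg]
  ring

theorem infCocycle_skew (hB : IsInvariantMagnetic B δ) (ξ η : E) :
    infCocycle δ ξ η = -infCocycle δ η ξ := by
  rw [infCocycle_apply hB.smooth_potential, infCocycle_apply hB.smooth_potential,
    ← hB.apply_rightMap 1, ← hB.apply_rightMap 1, two_form_swap, lieBr_skew, map_neg]
  ring

end Potentials

/-! ### The affine action, its isotropy group and the form B + d⟨μ + δ, 𝓐⟩. -/

section AffineOrbits

variable {E : Type*} [NormedAddCommGroup E] [NormedSpace ℝ E]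
variable {G : Type*} [TopologicalSpace G] [ChartedSpace E G] [Group G]

/-- The left action `(g, ν) ↦ Ad^*_{g⁻¹} ν - σ_δ(g)` underlying the affine right action. -/
def leftAffine (δ : G → E →L[ℝ] ℝ) (g : G) (ν : E →L[ℝ] ℝ) : E →L[ℝ] ℝ :=
  affineAction (-cocycle δ) g⁻¹ ν

theorem leftAffine_eq (δ : G → E →L[ℝ] ℝ) (g : G) (ν : E →L[ℝ] ℝ) :
    leftAffine δ g ν = coAd g⁻¹ ν - cocycle δ g := by
  rw [leftAffine, affineAction, inv_inv, Pi.neg_apply, sub_eq_add_neg]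

theorem coAd_one (ν : E →L[ℝ] ℝ) : coAd (1 : G) ν = ν := by
  rw [coAd, Ad_one, ContinuousLinearMap.comp_id]

theorem coAd_sub (g : G) (ν ν' : E →L[ℝ] ℝ) : coAd g (ν - ν') = coAd g ν - coAd g ν' :=
  ContinuousLinearMap.sub_comp _ _ _

theorem coAd_add (g : G) (ν ν' : E →L[ℝ] ℝ) : coAd g (ν + ν') = coAd g ν + coAd g ν' :=
  ContinuousLinearMap.add_comp _ _ _

theorem contDiff_leftAffine (δ : G → E →L[ℝ] ℝ) (g : G) : ContDiff ℝ ∞ (leftAffine δ g) := by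
  have h : leftAffine δ g =
      fun ν => (ContinuousLinearMap.compL ℝ E E ℝ).flip (Ad g⁻¹) ν - cocycle δ g :=
    funext (leftAffine_eq δ g)
  rw [h]
  exact (ContinuousLinearMap.contDiff _).sub contDiff_const

theorem affineOrbit_eq (δ : G → E →L[ℝ] ℝ) (μ : E →L[ℝ] ℝ) :
    affineOrbit δ μ = Set.range fun g : G => leftAffine δ g μ := by
  ext ν
  constructor
  · rintro ⟨g, rfl⟩
    exact ⟨g⁻¹, by simp only [leftAffine, inv_inv]⟩
  · rintro ⟨g, rfl⟩
    exact ⟨g⁻¹, rfl⟩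

theorem leftAffine_one (δ : G → E →L[ℝ] ℝ) (ν : E →L[ℝ] ℝ) : leftAffine δ 1 ν = ν := by
  rw [leftAffine_eq, cocycle, inv_one, coAd_one, coAd_one, sub_self, sub_zero]

variable [LieGroup 𝓘(ℝ, E) ∞ G] {B : DiffForm E G 2} {δ : G → E →L[ℝ] ℝ}

theorem coAd_mul (g h : G) (ν : E →L[ℝ] ℝ) : coAd (g * h) ν = coAd h (coAd g ν) := by
  rw [coAd, coAd, coAd, Ad_mul]
  rfl

/-- Independence of the base point, used with p = h⁻¹. -/
theorem cocycle_mul [PreconnectedSpace G] (hB : IsInvariantMagnetic B δ) (g h : G) :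
    cocycle δ (g * h) = cocycle δ g + coAd g⁻¹ (cocycle δ h) := by
  rw [cocycle_eq hB h⁻¹ g, cocycle, cocycle, mul_inv_rev, coAd_sub, coAd_mul]
  abel

theorem leftAffine_mul [PreconnectedSpace G] (hB : IsInvariantMagnetic B δ) (g h : G)
    (ν : E →L[ℝ] ℝ) : leftAffine δ (g * h) ν = leftAffine δ g (leftAffine δ h ν) := by
  rw [leftAffine_eq, leftAffine_eq, leftAffine_eq, cocycle_mul hB, mul_inv_rev, coAd_mul, coAd_sub]
  abel

/-- Base point p = g. The form and the Routhian are written with μ + δ(g), and this identity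
converts them into functions of the orbit point. -/
theorem leftAffine_eq_coAd_add [PreconnectedSpace G] (hB : IsInvariantMagnetic B δ) (g : G)
    (μ : E →L[ℝ] ℝ) : leftAffine δ g μ + δ 1 = coAd g⁻¹ (μ + δ g) := by
  rw [leftAffine_eq, cocycle_eq hB g, mul_inv_cancel, coAd_add]
  abel

theorem contMDiff_leftAffine (hδ : ContMDiff 𝓘(ℝ, E) 𝓘(ℝ, E →L[ℝ] ℝ) ∞ δ) (μ : E →L[ℝ] ℝ) :
    ContMDiff 𝓘(ℝ, E) 𝓘(ℝ, E →L[ℝ] ℝ) ∞ fun g : G => leftAffine δ g μ := by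
  have h : (fun g : G => leftAffine δ g μ) =
      fun g => ContinuousLinearMap.compL ℝ E E ℝ μ (Ad g⁻¹) - cocycle δ g :=
    funext fun g => leftAffine_eq δ g μ
  rw [h]
  exact ((ContinuousLinearMap.compL ℝ E E ℝ μ).contMDiff.comp contMDiff_Ad_inv).sub
    (contMDiff_cocycle hδ)

/-- The isotropy group of `μ` for the affine action. -/
def isotropy [PreconnectedSpace G] (hB : IsInvariantMagnetic B δ) (μ : E →L[ℝ] ℝ) :
    Subgroup G where
  carrier := {g | affineAction (-cocycle δ) g μ = μ}
  one_mem' := by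
    have h := leftAffine_one δ μ
    rwa [leftAffine, inv_one] at h
  mul_mem' := by
    intro g h (hg : _ = _) (hh : _ = _)
    have h1 := leftAffine_mul hB h⁻¹ g⁻¹ μ
    rw [leftAffine, leftAffine, leftAffine, ← mul_inv_rev, inv_inv, inv_inv, inv_inv, hg, hh] at h1
    exact h1
  inv_mem' := by
    intro g (hg : _ = _)
    have h1 := leftAffine_mul hB g g⁻¹ μ
    rw [mul_inv_cancel, leftAffine_one, leftAffine, leftAffine, inv_inv, hg] at h1
    exact h1.symm

theorem leftAffine_eq_iff [PreconnectedSpace G] (hB : IsInvariantMagnetic B δ) (μ : E →L[ℝ] ℝ)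
    (g h : G) : leftAffine δ g μ = leftAffine δ h μ ↔ g⁻¹ * h ∈ isotropy hB μ := by
  have h1 : g⁻¹ * h ∈ isotropy hB μ ↔ leftAffine δ (g⁻¹ * h) μ = μ := by
    rw [← inv_mem_iff]
    rfl
  have h2 : ∀ ν, leftAffine δ g⁻¹ (leftAffine δ g ν) = ν := fun ν => by
    rw [← leftAffine_mul hB, inv_mul_cancel, leftAffine_one]
  have h3 : ∀ ν, leftAffine δ g (leftAffine δ g⁻¹ ν) = ν := fun ν => by
    rw [← leftAffine_mul hB, mul_inv_cancel, leftAffine_one]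
  rw [h1, leftAffine_mul hB]
  constructor
  · intro h
    rw [← h, h2]
  · intro h
    conv_lhs => rw [← h, h3]

/-- The form `B + d⟨μ + δ, 𝓐⟩` on `G`. -/
def shiftedForm (B : DiffForm E G 2) (δ : G → E →L[ℝ] ℝ) (μ : E →L[ℝ] ℝ) : DiffForm E G 2 :=
  B + (pairMC (fun g : G => μ + δ g)).d

theorem isSmooth_shiftedForm [FiniteDimensional ℝ E] (hB : IsInvariantMagnetic B δ) (μ : E →L[ℝ] ℝ) :
    (shiftedForm B δ μ).IsSmooth :=
  hB.smooth_form.add (isSmooth_pairMC (f := fun g : G => μ + δ g) (contMDiff_const.add hB.smooth_potential)).d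

theorem d_shiftedForm [FiniteDimensional ℝ E] (hB : IsInvariantMagnetic B δ) (μ : E →L[ℝ] ℝ) :
    (shiftedForm B δ μ).d = 0 := by
  have h := isSmooth_pairMC (f := fun g : G => μ + δ g) (contMDiff_const.add hB.smooth_potential)
  rw [shiftedForm, hB.smooth_form.d_add h.d, hB.closed, h.d_d, add_zero]

variable [CompleteSpace E] [FiniteDimensional ℝ E]

theorem orbitVector_apply (δ : G → E →L[ℝ] ℝ) (ξ η : E) (ν : E →L[ℝ] ℝ) :
    orbitVector δ ξ ν η = -ν (lieBr G ξ η) + infCocycle δ ξ η := rfl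

theorem orbitVector_skew (hB : IsInvariantMagnetic B δ) (ξ η : E) (ν : E →L[ℝ] ℝ) :
    orbitVector δ ξ ν η = -orbitVector δ η ν ξ := by
  rw [orbitVector_apply, orbitVector_apply, lieBr_skew, infCocycle_skew hB, map_neg]
  ring

/-- The action law gives f(hg) = `leftAffine δ h (f g)`; differentiate at h = 1. -/
theorem tderiv_leftAffine_rightMap [PreconnectedSpace G] (hB : IsInvariantMagnetic B δ)
    (μ : E →L[ℝ] ℝ) (g : G) (ξ : E) :
    tderiv E (E →L[ℝ] ℝ) (fun h : G => leftAffine δ h μ) g (rightMap g ξ) =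
      orbitVector δ ξ (leftAffine δ g μ) := by
  have hδ := hB.smooth_potential
  let L := ContinuousLinearMap.compL ℝ E E ℝ (leftAffine δ g μ)
  have h1 : (fun h : G => leftAffine δ (h * g) μ) = fun h => L (Ad h⁻¹) - cocycle δ h := by
    ext1 h
    rw [leftAffine_mul hB, leftAffine_eq δ h]
    rfl
  have h2 := tderiv_comp (g := fun h : G => leftAffine δ h μ) (f := fun h : G => h * g) (x := 1)
    ((contMDiff_leftAffine hδ μ).mdiffAt _) ((contMDiff_rightMul (E := E) g).mdiffAt _)
  rw [h1, one_mul, tderiv_sub (f := fun h : G => L (Ad h⁻¹)) ((L.contMDiff.comp contMDiff_Ad_inv).mdiffAt _)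
    ((contMDiff_cocycle hδ).mdiffAt _), tderiv_clm_comp L (contMDiff_Ad_inv.mdiffAt _)] at h2
  have h3 := DFunLike.congr_fun h2 ξ
  refine h3.symm.trans ?_
  ext η
  change leftAffine δ g μ (tderiv E (E →L[ℝ] E) (fun g : G => Ad (E := E) g⁻¹) 1 ξ η) +
    -(tderiv E (E →L[ℝ] ℝ) (cocycle δ) 1 ξ η) = _
  rw [tderiv_Ad_inv_one, map_neg]
  rfl

theorem range_tderiv_leftAffine [PreconnectedSpace G] (hB : IsInvariantMagnetic B δ)
    (μ : E →L[ℝ] ℝ) : LinearMap.range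
      (tderiv E (E →L[ℝ] ℝ) (fun h : G => leftAffine δ h μ) 1 : E →ₗ[ℝ] E →L[ℝ] ℝ) =
      orbitTangent δ μ := by
  have h : ∀ ξ, tderiv E (E →L[ℝ] ℝ) (fun h : G => leftAffine δ h μ) 1 ξ = orbitVector δ ξ μ := by
    intro ξ
    have := tderiv_leftAffine_rightMap hB μ 1 ξ
    rwa [rightMap_one, leftAffine_one] at this
  ext w
  constructor
  · rintro ⟨ξ, rfl⟩
    exact ⟨ξ, (h ξ).symm⟩
  · rintro ⟨ξ, rfl⟩
    exact ⟨ξ, h ξ⟩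

/-- With T = ⟨T_eδ(ξ), η⟩, the term B contributes -T, the two derivative terms of Cartan's formula
contribute 2T, and the bracket term is -⟨ν + δ(e), [ξ, η]⟩. The sum is -⟨ν, [ξ, η]⟩ + Σ_δ(ξ, η). -/
theorem shiftedForm_rightMap [PreconnectedSpace G] (hB : IsInvariantMagnetic B δ)
    (μ : E →L[ℝ] ℝ) (g : G) (ξ η : E) :
    (shiftedForm B δ μ).at g ![rightMap g ξ, rightMap g η] =
      orbitVector δ ξ (leftAffine δ g μ) η := by
  have hδ := hB.smooth_potential
  have h1 : (shiftedForm B δ μ).at g ![rightMap g ξ, rightMap g η] =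
      B.at g ![rightMap g ξ, rightMap g η] +
        (pairMC (fun g : G => μ + δ g)).d.at g ![rightMap g ξ, rightMap g η] := rfl
  have h2 : ∀ ξ η : E, tderiv E (E →L[ℝ] ℝ) δ g (rightMap g ξ) (Ad g⁻¹ η) =
      tderiv E (E →L[ℝ] ℝ) δ 1 ξ η := by
    intro ξ η
    rw [← hB.apply_leftMap, ← rightMap_eq_leftMap_Ad_inv, hB.apply_rightMap]
  have h3 : tderiv E (E →L[ℝ] ℝ) δ 1 η ξ = -tderiv E (E →L[ℝ] ℝ) δ 1 ξ η := by
    rw [← hB.apply_rightMap 1, ← hB.apply_rightMap 1, two_form_swap]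
  have h4 : leftAffine δ g μ (lieBr G ξ η) + δ 1 (lieBr G ξ η) =
      (μ + δ g) (Ad g⁻¹ (lieBr G ξ η)) :=
    DFunLike.congr_fun (leftAffine_eq_coAd_add hB g μ) (lieBr G ξ η)
  have h5 : (pairMC (fun g : G => μ + δ g)).d.at g ![rightMap g ξ, rightMap g η] =
      tderiv E (E →L[ℝ] ℝ) δ g (rightMap g ξ) (Ad g⁻¹ η) -
        tderiv E (E →L[ℝ] ℝ) δ g (rightMap g η) (Ad g⁻¹ ξ) -
        (μ + δ g) (Ad g⁻¹ (lieBr G ξ η)) := by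
    rw [rightMap_eq_leftMap_Ad_inv, rightMap_eq_leftMap_Ad_inv,
      d_pairMC_leftMap (f := fun g : G => μ + δ g) (contMDiff_const.add hδ), tderiv_const_add μ (hδ.mdiffAt g), lieBr_Ad]
  rw [h1, h5, h2, h2, hB.apply_rightMap, ← h4, orbitVector_apply, infCocycle_apply hδ, h3]
  ring

end AffineOrbits

/-! ### The reduced symplectic form on a manifold model of the orbit. -/

section OrbitManifolds

variable {E : Type*} [NormedAddCommGroup E] [NormedSpace ℝ E]
variable {V : Type*} [NormedAddCommGroup V] [NormedSpace ℝ V]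
variable {G : Type*} [TopologicalSpace G] [ChartedSpace E G] [Group G]
variable {M : Type*} [TopologicalSpace M] [ChartedSpace V M]

variable (V) in
/-- `M` is a manifold model of the affine orbit of `μ`: the orbit map factors as a surjective
submersion `π : G → M` followed by an immersion `j`. -/
structure IsOrbitModel (δ : G → E →L[ℝ] ℝ) (μ : E →L[ℝ] ℝ) (π : G → M) (j : M → E →L[ℝ] ℝ) :
    Prop where
  smooth_proj : ContMDiff 𝓘(ℝ, E) 𝓘(ℝ, V) ∞ π
  surjective_proj : Function.Surjective π
  surjective_tderiv : ∀ g, Function.Surjective (tderiv E V π g)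
  exists_lift : ∀ x : M, ∃ s : V → G, ∀ y ∈ (extChartAt 𝓘(ℝ, V) x).target,
    ContMDiffAt 𝓘(ℝ, V) 𝓘(ℝ, E) ∞ s y ∧ (extChartAt 𝓘(ℝ, V) x).symm y = π (s y)
  smooth_incl : ContMDiff 𝓘(ℝ, V) 𝓘(ℝ, E →L[ℝ] ℝ) ∞ j
  injective_tderiv : ∀ m, Function.Injective (tderiv V (E →L[ℝ] ℝ) j m)
  incl_proj : ∀ g, j (π g) = leftAffine δ g μ

variable {δ : G → E →L[ℝ] ℝ} {μ : E →L[ℝ] ℝ} {π : G → M} {j : M → E →L[ℝ] ℝ}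
variable {B : DiffForm E G 2}

theorem rightMap_surjective [LieGroup 𝓘(ℝ, E) ∞ G] (g : G) (v : E) : ∃ ξ, rightMap g ξ = v :=
  ⟨_, rightMap_tderiv_mul_inv g v⟩

theorem two_form_ext {α β : V [⋀^Fin 2]→L[ℝ] ℝ} (h : ∀ v w, α ![v, w] = β ![v, w]) : α = β := by
  ext v
  have hv : v = ![v 0, v 1] := by ext1 i; fin_cases i <;> rfl
  rw [hv, h]

theorem two_form_comp {U : Type*} [NormedAddCommGroup U] [NormedSpace ℝ U]
    (α : V [⋀^Fin 2]→L[ℝ] ℝ) (A : U →L[ℝ] V) (v w : U) :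
    α.compContinuousLinearMap A ![v, w] = α ![A v, A w] := by
  rw [ContinuousAlternatingMap.compContinuousLinearMap_apply]
  congr 1
  ext1 i
  fin_cases i <;> rfl

namespace IsOrbitModel

theorem tangent_mk (hM : IsOrbitModel V δ μ π j) [LieGroup 𝓘(ℝ, E) ∞ G] (g : G) (v : V) : ∃ ξ, tderiv E V π g (rightMap g ξ) = v := by
  obtain ⟨u, rfl⟩ := hM.surjective_tderiv g v
  obtain ⟨ξ, rfl⟩ := rightMap_surjective g u
  exact ⟨ξ, rfl⟩

theorem pullback_ext (hM : IsOrbitModel V δ μ π j) {Ω Ω' : DiffForm V M 2}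
    (h : Ω.pullback (F := E) π = Ω'.pullback (F := E) π) : Ω = Ω' := by
  refine DiffForm.eq_of_at fun m => two_form_ext fun v w => ?_
  obtain ⟨g, rfl⟩ := hM.surjective_proj m
  obtain ⟨v, rfl⟩ := hM.surjective_tderiv g v
  obtain ⟨w, rfl⟩ := hM.surjective_tderiv g w
  have h1 : (Ω.pullback (F := E) π).at g = (Ω'.pullback (F := E) π).at g := by rw [h]
  rw [DiffForm.pullback_at, DiffForm.pullback_at] at h1
  rw [← two_form_comp, h1, two_form_comp]

variable [LieGroup 𝓘(ℝ, E) ∞ G] [CompleteSpace E] [FiniteDimensional ℝ E] [PreconnectedSpace G]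

theorem tderiv_incl_proj (hM : IsOrbitModel V δ μ π j) (hB : IsInvariantMagnetic B δ) {m : M} {g : G}
    (hg : π g = m) (ξ : E) : tderiv V (E →L[ℝ] ℝ) j m (tderiv E V π g (rightMap g ξ)) =
      orbitVector δ ξ (j m) := by
  subst hg
  have h1 := tderiv_comp (hM.smooth_incl.mdiffAt (π g)) (hM.smooth_proj.mdiffAt g)
  have h2 : (fun g => j (π g)) = fun g => leftAffine δ g μ := funext hM.incl_proj
  rw [h2] at h1
  rw [hM.incl_proj, ← tderiv_leftAffine_rightMap hB, h1]
  rfl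

theorem exists_orbitVector (hM : IsOrbitModel V δ μ π j) (hB : IsInvariantMagnetic B δ) (m : M)
    (v : V) : ∃ ξ, tderiv V (E →L[ℝ] ℝ) j m v = orbitVector δ ξ (j m) := by
  obtain ⟨g, rfl⟩ := hM.surjective_proj m
  obtain ⟨ξ, rfl⟩ := hM.tangent_mk g v
  exact ⟨ξ, hM.tderiv_incl_proj hB rfl ξ⟩

/-- The form is defined by arbitrary choices of preimages and of linear sections of Tπ; smoothness
is proved later, from the pull-back alone. -/
theorem exists_form (hM : IsOrbitModel V δ μ π j) (hB : IsInvariantMagnetic B δ) :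
    ∃ Ω : DiffForm V M 2, Ω.pullback (F := E) π = shiftedForm B δ μ := by
  choose γ hγ using hM.surjective_proj
  have hs : ∀ m, ∃ s : V →L[ℝ] E, ∀ v, tderiv E V π (γ m) (s v) = v := by
    intro m
    have hfin : FiniteDimensional ℝ V :=
      Module.Finite.of_surjective (tderiv E V π (γ m) : E →ₗ[ℝ] V) (hM.surjective_tderiv _)
    obtain ⟨s, hs⟩ := (tderiv E V π (γ m) : E →ₗ[ℝ] V).exists_rightInverse_of_surjective
      (LinearMap.range_eq_top.2 (hM.surjective_tderiv _))
    exact ⟨LinearMap.toContinuousLinearMap s, fun v => LinearMap.congr_fun hs v⟩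
  choose s hs using hs
  let Ω : DiffForm V M 2 := fun m =>
    ((shiftedForm B δ μ).at (γ m)).compContinuousLinearMap (s m)
  refine ⟨Ω, DiffForm.eq_of_at fun g => two_form_ext fun v w => ?_⟩
  have hΩ : Ω.at (π g) = ((shiftedForm B δ μ).at (γ (π g))).compContinuousLinearMap (s (π g)) := rfl
  rw [DiffForm.pullback_at, two_form_comp, hΩ, two_form_comp]
  obtain ⟨ξ, rfl⟩ := rightMap_surjective g v
  obtain ⟨η, rfl⟩ := rightMap_surjective g w
  -- Independence of the choices: two lifts of one tangent vector have the same image under Tj,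
  -- hence the same orbit vector. Skewness then lets the second argument be replaced like the first.
  have key : ∀ ξ ξ' : E, rightMap (γ (π g)) ξ' = s (π g) (tderiv E V π g (rightMap g ξ)) →
      orbitVector δ ξ' (j (π g)) = orbitVector δ ξ (j (π g)) := by
    intro ξ ξ' h
    rw [← hM.tderiv_incl_proj hB (hγ (π g)), h, hs, hM.tderiv_incl_proj hB rfl]
  obtain ⟨ξ', hξ⟩ := rightMap_surjective (γ (π g)) (s (π g) (tderiv E V π g (rightMap g ξ)))
  obtain ⟨η', hη⟩ := rightMap_surjective (γ (π g)) (s (π g) (tderiv E V π g (rightMap g η)))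
  rw [← hξ, ← hη, shiftedForm_rightMap hB, shiftedForm_rightMap hB, ← hM.incl_proj, ← hM.incl_proj,
    hγ, key _ _ hξ, orbitVector_skew hB, key _ _ hη, ← orbitVector_skew hB]

theorem form_apply (hM : IsOrbitModel V δ μ π j) (hB : IsInvariantMagnetic B δ) {Ω : DiffForm V M 2}
    (hΩ : Ω.pullback (F := E) π = shiftedForm B δ μ) {m : M} {v w : V} {ξ η : E}
    (hv : tderiv V (E →L[ℝ] ℝ) j m v = orbitVector δ ξ (j m))
    (hw : tderiv V (E →L[ℝ] ℝ) j m w = orbitVector δ η (j m)) :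
    Ω.at m ![v, w] = orbitVector δ ξ (j m) η := by
  obtain ⟨g, rfl⟩ := hM.surjective_proj m
  have h1 : v = tderiv E V π g (rightMap g ξ) :=
    hM.injective_tderiv _ (hv.trans (hM.tderiv_incl_proj hB rfl ξ).symm)
  have h2 : w = tderiv E V π g (rightMap g η) :=
    hM.injective_tderiv _ (hw.trans (hM.tderiv_incl_proj hB rfl η).symm)
  rw [h1, h2, ← two_form_comp, ← DiffForm.pullback_at, hΩ, shiftedForm_rightMap hB, hM.incl_proj]

/-- Nondegeneracy: pairing v with the projection of ηg evaluates the covector Tj(v) at η, so a null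
vector satisfies Tj(v) = 0, and Tj is injective. -/
theorem isSymplectic (hM : IsOrbitModel V δ μ π j) (hB : IsInvariantMagnetic B δ)
    [FiniteDimensional ℝ V] [IsManifold 𝓘(ℝ, V) ∞ M] {Ω : DiffForm V M 2}
    (hΩ : Ω.pullback (F := E) π = shiftedForm B δ μ) : Ω.IsSymplectic := by
  have h := DiffForm.smooth_closed_of_pullback hM.smooth_proj hM.exists_lift Ω
    (hΩ ▸ isSmooth_shiftedForm hB μ) (hΩ ▸ d_shiftedForm hB μ)
  refine ⟨h.1, h.2, fun m (v : V) hv => ?_⟩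
  change ∀ w : V, Ω.at m ![v, w] = 0 at hv
  obtain ⟨ξ, hξ⟩ := hM.exists_orbitVector hB m v
  obtain ⟨g, hg⟩ := hM.surjective_proj m
  refine hM.injective_tderiv m (hξ.trans (Eq.trans ?_ (map_zero _).symm))
  ext η
  exact (hM.form_apply hB hΩ hξ (hM.tderiv_incl_proj hB hg η)).symm.trans (hv _)

end IsOrbitModel

end OrbitManifolds

/-! ### Right-invariant Lagrangians and the Legendre transform. -/

section Legendre

variable {E : Type*} [NormedAddCommGroup E] [NormedSpace ℝ E]
variable {G : Type*} [TopologicalSpace G] [ChartedSpace E G] [Group G] [LieGroup 𝓘(ℝ, E) ∞ G]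
variable {δ : G → E →L[ℝ] ℝ} {ℓ : E → ℝ}

theorem lagrangian_rightMap (ℓ : E → ℝ) (g : G) (ξ : E) :
    lagrangian ℓ g (rightMap (E := E) g ξ) = ℓ ξ :=
  congrArg ℓ (tderiv_mul_inv_rightMap g ξ)

theorem maurerCartan_rightMap (g : G) (ξ : E) :
    mcMap (E := E) g (rightMap g ξ) = Ad g⁻¹ ξ := by
  rw [rightMap_eq_leftMap_Ad_inv, mcMap_leftMap]

theorem momentum_rightMap (hℓ : ContDiff ℝ ∞ ℓ) (δ : G → E →L[ℝ] ℝ) (g : G) (ξ : E) :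
    momentum ℓ δ g (rightMap (E := E) g ξ) = (fderiv ℝ ℓ ξ).comp (Ad g) - δ g := by
  set R : E →L[ℝ] E := tderiv E E (fun h : G => h * g⁻¹) g with hR
  have h1 : fderiv ℝ (fun w : E => ℓ (R w)) (rightMap g ξ) = (fderiv ℝ ℓ ξ).comp R := by
    have h0 : R (rightMap g ξ) = ξ := tderiv_mul_inv_rightMap g ξ
    have := ((hℓ.differentiable (by simp)) (R (rightMap g ξ))).hasFDerivAt.comp (rightMap g ξ)
      R.hasFDerivAt
    rw [h0] at this
    exact this.fderiv
  have h2 : momentum ℓ δ g (rightMap (E := E) g ξ) =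
      (fderiv ℝ (fun w : E => ℓ (R w)) (rightMap g ξ)).comp (leftMap g) - δ g := rfl
  rw [h2, h1]
  congr 1
  ext η
  change fderiv ℝ ℓ ξ (R (leftMap g η)) = fderiv ℝ ℓ ξ (Ad g η)
  rw [← rightMap_Ad, hR, tderiv_mul_inv_rightMap]

/-- At g = 1 and v = 0 the diffeomorphism provided by regularity is 𝔽ℓ - δ(e). -/
theorem IsGRegular.exists_inverse (h : IsGRegular ℓ δ) (hℓ : ContDiff ℝ ∞ ℓ) :
    ∃ χ : (E →L[ℝ] ℝ) → E, ContDiff ℝ ∞ χ ∧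
      (∀ ν : E →L[ℝ] ℝ, fderiv ℝ ℓ (χ ν) = ν) ∧ (∀ ξ : E, χ (fderiv ℝ ℓ ξ) = ξ) := by
  obtain ⟨Φ, hΦ⟩ := h 1 (0 : E)
  have h1 : ∀ ξ, Φ ξ = fderiv ℝ ℓ ξ - δ 1 := by
    intro ξ
    have h2 : ((0 : E) + leftMap (1 : G) ξ : E) = rightMap (1 : G) ξ := by
      rw [zero_add, leftMap_one, rightMap_one]
    have h3 := momentum_rightMap hℓ δ 1 ξ
    rw [Ad_one, ContinuousLinearMap.comp_id] at h3
    exact (hΦ ξ).trans ((congrArg (fun v : E => momentum ℓ δ 1 v) h2).trans h3)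
  refine ⟨fun ν => Φ.symm (ν - δ 1), ?_, fun ν => ?_, fun ξ => ?_⟩
  · exact Φ.symm.contMDiff.contDiff.comp (contDiff_id.sub contDiff_const)
  · have := h1 (Φ.symm (ν - δ 1))
    rw [Φ.apply_symm_apply] at this
    exact (sub_left_injective this).symm
  · beta_reduce
    rw [← h1, Φ.symm_apply_apply]

/-- Minus the Legendre transform of `ℓ`, in terms of the inverse `χ` of the fibre derivative. -/
def legendreEnergy (ℓ : E → ℝ) (χ : (E →L[ℝ] ℝ) → E) (ν : E →L[ℝ] ℝ) : ℝ := ℓ (χ ν) - ν (χ ν)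

theorem contDiff_legendreEnergy {χ : (E →L[ℝ] ℝ) → E} (hℓ : ContDiff ℝ ∞ ℓ)
    (hχ : ContDiff ℝ ∞ χ) : ContDiff ℝ ∞ (legendreEnergy ℓ χ) :=
  (hℓ.comp hχ).sub (contDiff_id.clm_apply hχ)

/-- The two terms containing the derivative of χ cancel because 𝔽ℓ(χ(ν)) = ν. -/
theorem fderiv_legendreEnergy {χ : (E →L[ℝ] ℝ) → E} (hℓ : ContDiff ℝ ∞ ℓ) (hχ : ContDiff ℝ ∞ χ)
    (h : ∀ ν, fderiv ℝ ℓ (χ ν) = ν) (ν w : E →L[ℝ] ℝ) :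
    fderiv ℝ (legendreEnergy ℓ χ) ν w = -w (χ ν) := by
  have h1 : HasFDerivAt χ (fderiv ℝ χ ν) ν := (hχ.differentiable (by simp) ν).hasFDerivAt
  have h2 : HasFDerivAt ℓ ν (χ ν) := by
    have := (hℓ.differentiable (by simp) (χ ν)).hasFDerivAt
    rwa [h] at this
  have h3 : HasFDerivAt (legendreEnergy ℓ χ) _ ν :=
    (h2.comp ν h1).sub ((hasFDerivAt_id ν).clm_apply h1)
  rw [h3.fderiv]
  simp

end Legendre

/-! ### The Routhian and the reduced Euler–Lagrange equations. -/

section Routhians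

variable {E : Type*} [NormedAddCommGroup E] [NormedSpace ℝ E]
variable {V : Type*} [NormedAddCommGroup V] [NormedSpace ℝ V]
variable {G : Type*} [TopologicalSpace G] [ChartedSpace E G] [Group G]
variable {M : Type*} [TopologicalSpace M] [ChartedSpace V M]
variable {δ : G → E →L[ℝ] ℝ} {μ : E →L[ℝ] ℝ} {π : G → M} {j : M → E →L[ℝ] ℝ}
variable {B : DiffForm E G 2} {ℓ : E → ℝ} {χ : (E →L[ℝ] ℝ) → E}

/-- The Routhian as a function of the point `j m` of the affine orbit. -/
def routhian (ℓ : E → ℝ) (χ : (E →L[ℝ] ℝ) → E) (δ : G → E →L[ℝ] ℝ) (j : M → E →L[ℝ] ℝ) (m : M) :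
    ℝ :=
  legendreEnergy ℓ χ (j m + δ 1)

namespace IsOrbitModel

theorem contMDiff_routhian (hM : IsOrbitModel V δ μ π j) (hℓ : ContDiff ℝ ∞ ℓ)
    (hχ : ContDiff ℝ ∞ χ) : ContMDiff 𝓘(ℝ, V) 𝓘(ℝ, ℝ) ∞ (routhian ℓ χ δ j) :=
  (contDiff_legendreEnergy hℓ hχ).contMDiff.comp (hM.smooth_incl.add contMDiff_const)

theorem tderiv_routhian (hM : IsOrbitModel V δ μ π j) (hℓ : ContDiff ℝ ∞ ℓ) (hχs : ContDiff ℝ ∞ χ)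
    (hχ' : ∀ ν, fderiv ℝ ℓ (χ ν) = ν) (hδ : δ 1 = 0) (m : M) (w : V) :
    tderiv V ℝ (routhian ℓ χ δ j) m w = -tderiv V (E →L[ℝ] ℝ) j m w (χ (j m)) := by
  have h1 : routhian ℓ χ δ j = fun m => legendreEnergy ℓ χ (j m) := by
    ext1 m
    rw [routhian, hδ, add_zero]
  rw [h1, tderiv_comp (g := legendreEnergy ℓ χ) (f := j)
    ((contDiff_legendreEnergy hℓ hχs).contMDiff.mdiffAt _) (hM.smooth_incl.mdiffAt m),
    tderiv_eq_fderiv, ContinuousLinearMap.comp_apply, fderiv_legendreEnergy hℓ hχs hχ']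

end IsOrbitModel

variable [LieGroup 𝓘(ℝ, E) ∞ G]

theorem momentum_eq_iff [PreconnectedSpace G] (hB : IsInvariantMagnetic B δ) (hℓ : ContDiff ℝ ∞ ℓ)
    (g : G) (ξ : E) (μ : E →L[ℝ] ℝ) :
    momentum ℓ δ g (rightMap (E := E) g ξ) = μ ↔ fderiv ℝ ℓ ξ = leftAffine δ g μ + δ 1 := by
  rw [momentum_rightMap hℓ, leftAffine_eq_coAd_add hB, sub_eq_iff_eq_add]
  constructor
  · intro h
    rw [← h]
    ext η
    exact congrArg (fderiv ℝ ℓ ξ) (Ad_Ad_inv g η).symm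
  · intro h
    rw [h]
    ext η
    exact congrArg (μ + δ g) (Ad_inv_Ad g η)

theorem routhian_value [PreconnectedSpace G] (hB : IsInvariantMagnetic B δ) {g : G} {ξ : E}
    (h1 : fderiv ℝ ℓ ξ = leftAffine δ g μ + δ 1) (hχ : ∀ ξ, χ (fderiv ℝ ℓ ξ) = ξ) :
    legendreEnergy ℓ χ (leftAffine δ g μ + δ 1) =
      lagrangian ℓ g (rightMap (E := E) g ξ) - (μ + δ g) (mcMap (E := E) g (rightMap g ξ)) := by
  have h2 : (leftAffine δ g μ + δ 1) ξ = (μ + δ g) (Ad g⁻¹ ξ) :=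
    DFunLike.congr_fun (leftAffine_eq_coAd_add hB g μ) ξ
  rw [lagrangian_rightMap, maurerCartan_rightMap, ← h2, legendreEnergy, ← h1, hχ]

namespace IsOrbitModel

variable [PreconnectedSpace G]

theorem isRouthian (hM : IsOrbitModel V δ μ π j) (hB : IsInvariantMagnetic B δ)
    (hℓ : ContDiff ℝ ∞ ℓ) (hχ : ∀ ξ, χ (fderiv ℝ ℓ ξ) = ξ) :
    IsRouthian ℓ δ μ π (routhian ℓ χ δ j) := by
  intro g (v : E) hv
  obtain ⟨ξ, rfl⟩ := rightMap_surjective g v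
  rw [routhian, hM.incl_proj]
  exact routhian_value hB ((momentum_eq_iff hB hℓ g ξ μ).1 hv) hχ

/-- Over every g the level set contains the vector χ(ν + δ(e))g, so the defining condition
determines the value at every coset. -/
theorem eq_routhian (hM : IsOrbitModel V δ μ π j) (hB : IsInvariantMagnetic B δ)
    (hℓ : ContDiff ℝ ∞ ℓ) (hχ : ∀ ξ, χ (fderiv ℝ ℓ ξ) = ξ) (hχ' : ∀ ν, fderiv ℝ ℓ (χ ν) = ν)
    {Lt : M → ℝ} (h : IsRouthian ℓ δ μ π Lt) : Lt = routhian ℓ χ δ j := by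
  ext m
  obtain ⟨g, rfl⟩ := hM.surjective_proj m
  have hv := (momentum_eq_iff hB hℓ g (χ (leftAffine δ g μ + δ 1)) μ).2 (hχ' _)
  exact (h g _ hv).trans (hM.isRouthian hB hℓ hχ g _ hv).symm

variable [CompleteSpace E] [FiniteDimensional ℝ E]

theorem eulerLagrange_iff (hM : IsOrbitModel V δ μ π j) (hB : IsInvariantMagnetic B δ)
    {Ω : DiffForm V M 2} (hΩ : Ω.pullback (F := E) π = shiftedForm B δ μ) (hℓ : ContDiff ℝ ∞ ℓ)
    (hχs : ContDiff ℝ ∞ χ) (hχ' : ∀ ν, fderiv ℝ ℓ (χ ν) = ν) (hδ : δ 1 = 0) {c : ℝ → M} {t : ℝ}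
    (hc : MDifferentiableAt 𝓘(ℝ, ℝ) 𝓘(ℝ, V) c t) :
    SolvesEulerLagrangeAt (routhian ℓ χ δ j) Ω c t ↔
      HasDerivAt (fun s => j (c s)) (orbitVector δ (χ (j (c t))) (j (c t))) t := by
  set u : V := tderiv ℝ V c t 1 with hu
  obtain ⟨ξ, hξ⟩ := hM.exists_orbitVector hB (c t) u
  have h1 : HasDerivAt (fun s => j (c s)) (orbitVector δ ξ (j (c t))) t := by
    have h2 : MDifferentiableAt 𝓘(ℝ, ℝ) 𝓘(ℝ, E →L[ℝ] ℝ) (fun s => j (c s)) t :=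
      (hM.smooth_incl.mdiffAt _).comp t hc
    have h3 := (mdifferentiableAt_iff_differentiableAt.1 h2).hasDerivAt
    rw [← fderiv_apply_one_eq_deriv, ← tderiv_eq_fderiv,
      tderiv_comp (hM.smooth_incl.mdiffAt _) hc, ContinuousLinearMap.comp_apply, ← hu, hξ] at h3
    exact h3
  have h4 : SolvesEulerLagrangeAt (routhian ℓ χ δ j) Ω c t ↔
      ∀ w : V, Ω.at (c t) ![u, w] = tderiv V ℝ (routhian ℓ χ δ j) (c t) w := Iff.rfl
  have h5 : (∀ w : V, Ω.at (c t) ![u, w] = tderiv V ℝ (routhian ℓ χ δ j) (c t) w) ↔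
      orbitVector δ ξ (j (c t)) = orbitVector δ (χ (j (c t))) (j (c t)) := by
    -- The differential of the Routhian on w is minus the η-orbit vector evaluated at χ(ν); skewness
    -- makes it the χ(ν)-orbit vector evaluated at η.
    have h6 : ∀ (w : V) (η : E), tderiv V (E →L[ℝ] ℝ) j (c t) w = orbitVector δ η (j (c t)) →
        (Ω.at (c t) ![u, w] = tderiv V ℝ (routhian ℓ χ δ j) (c t) w ↔
          orbitVector δ ξ (j (c t)) η = orbitVector δ (χ (j (c t))) (j (c t)) η) := by
      intro w η hw
      rw [hM.form_apply hB hΩ hξ hw, hM.tderiv_routhian hℓ hχs hχ' hδ, hw, ← orbitVector_skew hB]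
    constructor
    · intro h
      ext η
      obtain ⟨g, hg⟩ := hM.surjective_proj (c t)
      exact (h6 _ η (hM.tderiv_incl_proj hB hg η)).1 (h _)
    · intro h w
      obtain ⟨η, hη⟩ := hM.exists_orbitVector hB (c t) w
      exact (h6 w η hη).2 (by rw [h])
  rw [h4, h5]
  exact ⟨fun h => h ▸ h1, fun h => h1.unique h⟩

end IsOrbitModel

end Routhians

theorem injective_of_finrank_le_finrank_range {V W : Type*} [NormedAddCommGroup V]
    [NormedSpace ℝ V] [FiniteDimensional ℝ V] [NormedAddCommGroup W] [NormedSpace ℝ W]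
    (J : V →L[ℝ] W)
    (h : Module.finrank ℝ V ≤ Module.finrank ℝ (LinearMap.range (J : V →ₗ[ℝ] W))) :
    Function.Injective J := by
  have h5 := LinearMap.finrank_range_add_finrank_ker (J : V →ₗ[ℝ] W)
  exact LinearMap.ker_eq_bot.1 (Submodule.finrank_eq_zero.1 (by omega))

/-! ### The coset space of the isotropy group as an orbit model. -/

section OrbitSpaces

variable {E : Type*} [NormedAddCommGroup E] [NormedSpace ℝ E]
variable {G : Type*} [TopologicalSpace G] [ChartedSpace E G] [Group G] [LieGroup 𝓘(ℝ, E) ∞ G]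
variable [PreconnectedSpace G] {B : DiffForm E G 2} {δ : G → E →L[ℝ] ℝ}

/-- The identification of the coset space of the isotropy group with the affine orbit. -/
def orbitIncl (hB : IsInvariantMagnetic B δ) (μ : E →L[ℝ] ℝ) :
    G ⧸ isotropy hB μ → E →L[ℝ] ℝ :=
  Quotient.lift (s := QuotientGroup.leftRel (isotropy hB μ)) (fun g => leftAffine δ g μ)
    fun g h hgh => (leftAffine_eq_iff hB μ g h).2 (QuotientGroup.leftRel_apply.1 hgh)

theorem orbitIncl_injective (hB : IsInvariantMagnetic B δ) (μ : E →L[ℝ] ℝ) :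
    Function.Injective (orbitIncl hB μ) := by
  intro x y h
  obtain ⟨g, rfl⟩ := QuotientGroup.mk_surjective x
  obtain ⟨k, rfl⟩ := QuotientGroup.mk_surjective y
  exact QuotientGroup.eq.2 ((leftAffine_eq_iff hB μ g k).1 h)

theorem range_orbitIncl (hB : IsInvariantMagnetic B δ) (μ : E →L[ℝ] ℝ) :
    Set.range (orbitIncl hB μ) = affineOrbit δ μ := by
  rw [affineOrbit_eq]
  exact (Function.Surjective.range_comp QuotientGroup.mk_surjective (orbitIncl hB μ)).symm

variable [CompleteSpace E] [FiniteDimensional ℝ E]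

theorem IsOrbitModel.of_submersion (hB : IsInvariantMagnetic B δ) (μ : E →L[ℝ] ℝ)
    {V : Type*} [NormedAddCommGroup V] [NormedSpace ℝ V] [FiniteDimensional ℝ V]
    {M : Type*} [TopologicalSpace M] [ChartedSpace V M] [IsManifold 𝓘(ℝ, V) ∞ M]
    {π : G → M} {j : M → E →L[ℝ] ℝ} (hπ : ContMDiff 𝓘(ℝ, E) 𝓘(ℝ, V) ∞ π)
    (hsurj : Function.Surjective π) (htd : ∀ g, Function.Surjective (tderiv E V π g))
    (hlift : ∀ x : M, ∃ s : V → G, ∀ y ∈ (extChartAt 𝓘(ℝ, V) x).target,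
      ContMDiffAt 𝓘(ℝ, V) 𝓘(ℝ, E) ∞ s y ∧ (extChartAt 𝓘(ℝ, V) x).symm y = π (s y))
    (hfin : Module.finrank ℝ V ≤ Module.finrank ℝ (orbitTangent δ μ))
    (hj : ∀ g, j (π g) = leftAffine δ g μ) : IsOrbitModel V δ μ π j := by
  have hf := contMDiff_leftAffine hB.smooth_potential μ
  have hjs : ContMDiff 𝓘(ℝ, V) 𝓘(ℝ, E →L[ℝ] ℝ) ∞ j :=
    contMDiff_of_comp_lift hlift (by simpa only [hj] using hf)
  refine ⟨hπ, hsurj, htd, hlift, hjs, fun m => ?_, hj⟩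
  obtain ⟨g, rfl⟩ := hsurj m
  -- Constant rank gives Tj a range of dimension at least that of the orbit tangent space at μ,
  -- hence at least dim V; rank-nullity then yields injectivity.
  have h1 := finrank_range_tderiv_le hf (contDiff_leftAffine δ)
    (fun g h => leftAffine_mul hB g h μ) g 1
  rw [range_tderiv_leftAffine hB] at h1
  have h2 := tderiv_comp (hjs.mdiffAt (π g)) (hπ.mdiffAt g)
  simp only [hj] at h2
  have h3 : LinearMap.range (tderiv E (E →L[ℝ] ℝ) (fun h : G => leftAffine δ h μ) g :
      E →ₗ[ℝ] E →L[ℝ] ℝ) ≤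
      LinearMap.range (tderiv V (E →L[ℝ] ℝ) j (π g) : V →ₗ[ℝ] E →L[ℝ] ℝ) := by
    rw [h2]
    rintro _ ⟨v, rfl⟩
    exact ⟨_, rfl⟩
  exact injective_of_finrank_le_finrank_range _
    (hfin.trans (h1.trans (Submodule.finrank_mono h3)))

end OrbitSpaces

end RouthLie

end

/-! ### Assembly of the theorem. -/

open RouthLie in
theorem lemma5p12 {E : Type*} [NormedAddCommGroup E] [NormedSpace ℝ E] [FiniteDimensional ℝ E]
    [CompleteSpace E] {G : Type*} [TopologicalSpace G] [ChartedSpace E G] [Group G]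
    [LieGroup 𝓘(ℝ, E) ∞ G] [ConnectedSpace G]
    (B : DiffForm E G 2) (δ : G → E →L[ℝ] ℝ) (hB : IsInvariantMagnetic B δ)
    (μ : E →L[ℝ] ℝ) :
    -- the isotropy group of `μ`
    ∃ Gμ : Subgroup G, (∀ g : G, g ∈ Gμ ↔ affineAction (-cocycle δ) g μ = μ) ∧
    -- the quotient manifold `G/G_μ`
    ∃ _ : ChartedSpace (orbitTangent δ μ) (G ⧸ Gμ),
      IsManifold 𝓘(ℝ, orbitTangent δ μ) ∞ (G ⧸ Gμ) ∧
      IsSmoothSubmersion (F := E) (F' := orbitTangent δ μ) (fun g : G => (g : G ⧸ Gμ)) ∧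
    -- its identification with the affine orbit
    ∃ j : G ⧸ Gμ → E →L[ℝ] ℝ,
      (∀ g : G, j (g : G ⧸ Gμ) = affineAction (-cocycle δ) g⁻¹ μ) ∧
      Set.range j = affineOrbit δ μ ∧
      IsInjectiveImmersion (F := orbitTangent δ μ) (F' := E →L[ℝ] ℝ) j ∧
      (∀ (g : G) (ξ : E),
        mfderiv 𝓘(ℝ, orbitTangent δ μ) 𝓘(ℝ, E →L[ℝ] ℝ) j (g : G ⧸ Gμ)
          (mfderiv 𝓘(ℝ, E) 𝓘(ℝ, orbitTangent δ μ) (fun h : G => (h : G ⧸ Gμ)) g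
            (rightTranslate ξ g)) = orbitVector δ ξ (j (g : G ⧸ Gμ))) ∧
    -- the reduced form
    ∃ Ω : DiffForm (orbitTangent δ μ) (G ⧸ Gμ) 2,
      Ω.pullback (F := E) (fun g : G => (g : G ⧸ Gμ)) =
        B + (pairMC (fun g : G => μ + δ g)).d ∧
      (∀ Ω' : DiffForm (orbitTangent δ μ) (G ⧸ Gμ) 2,
        Ω'.pullback (F := E) (fun g : G => (g : G ⧸ Gμ)) =
          B + (pairMC (fun g : G => μ + δ g)).d → Ω' = Ω) ∧
      IsAffineKKS δ j Ω ∧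
      Ω.IsSymplectic ∧
    -- the reduced equations
      ∀ ℓ : E → ℝ, ContDiff ℝ ∞ ℓ → IsGRegular ℓ δ →
        ∃ χ : (E →L[ℝ] ℝ) → E, ContDiff ℝ ∞ χ ∧
          (∀ ν : E →L[ℝ] ℝ, fderiv ℝ ℓ (χ ν) = ν) ∧ (∀ ξ : E, χ (fderiv ℝ ℓ ξ) = ξ) ∧
        ∃ Lt : G ⧸ Gμ → ℝ,
          IsRouthian ℓ δ μ (fun g : G => (g : G ⧸ Gμ)) Lt ∧
          (∀ Lt' : G ⧸ Gμ → ℝ,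
            IsRouthian ℓ δ μ (fun g : G => (g : G ⧸ Gμ)) Lt' → Lt' = Lt) ∧
          ContMDiff 𝓘(ℝ, orbitTangent δ μ) 𝓘(ℝ, ℝ) ∞ Lt ∧
          (δ 1 = 0 → ∀ (c : ℝ → G ⧸ Gμ) (t : ℝ),
            MDifferentiableAt 𝓘(ℝ, ℝ) 𝓘(ℝ, orbitTangent δ μ) c t →
            (SolvesEulerLagrangeAt Lt Ω c t ↔
              HasDerivAt (fun s : ℝ => j (c s))
                (-coad G (χ (j (c t))) (j (c t)) + infCocycle δ (χ (j (c t)))) t)) := by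
  obtain ⟨κ, ⟨D⟩⟩ := exists_cosetSlice (contMDiff_leftAffine hB.smooth_potential μ)
    (contDiff_leftAffine δ) (fun g h => leftAffine_mul hB g h μ) (isotropy hB μ)
    (leftAffine_eq_iff hB μ) (orbitTangent δ μ) (range_tderiv_leftAffine hB μ)
  let _ := D.chartedSpace
  have := D.isManifold
  have hM : IsOrbitModel (orbitTangent δ μ) δ μ (fun g : G => (g : G ⧸ isotropy hB μ))
      (orbitIncl hB μ) :=
    IsOrbitModel.of_submersion hB μ D.contMDiff_mk QuotientGroup.mk_surjective
      -- The slice takes values in the orbit tangent space at μ, which is thus the model space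
      -- itself; the dimension bound is reflexivity.
      D.surjective_tderiv_mk D.exists_lift le_rfl fun _ => rfl
  obtain ⟨Ω, hΩ⟩ := hM.exists_form hB
  refine ⟨isotropy hB μ, fun _ => Iff.rfl, D.chartedSpace, D.isManifold,
    ⟨hM.smooth_proj, hM.surjective_tderiv⟩, orbitIncl hB μ, fun _ => rfl, range_orbitIncl hB μ,
    ⟨hM.smooth_incl, orbitIncl_injective hB μ, hM.injective_tderiv⟩,
    fun g ξ => hM.tderiv_incl_proj hB rfl ξ, Ω, hΩ,
    fun Ω' hΩ' => hM.pullback_ext (hΩ'.trans hΩ.symm),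
    fun m v w ξ η hv hw => hM.form_apply hB hΩ hv hw, hM.isSymplectic hB hΩ, ?_⟩
  intro ℓ hℓ hreg
  obtain ⟨χ, hχs, hχ, hχ'⟩ := hreg.exists_inverse hℓ
  exact ⟨χ, hχs, hχ, hχ', routhian ℓ χ δ (orbitIncl hB μ), hM.isRouthian hB hℓ hχ',
    fun Lt h => hM.eq_routhian hB hℓ hχ' hχ h, hM.contMDiff_routhian hℓ hχs,
    fun hδ c t hc => hM.eulerLagrange_iff hB hΩ hℓ hχs hχ hδ hc⟩
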